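/- Let $m\ge 0$, $n=2m$. This is the self-testing theorem for the parallelized Mayers–Yao test of $m=n/2$ maximally entangled pairs of qubits. **Ideal behaviour.** Alice and Bob share $|\psi\rangle=\bigl(\tfrac12(|00\rangle+|01\rangle+|10\rangle-|11\rangle)\bigr)^{\otimes m}$, Alice holding the first and Bob the second qubit of each pair. Number Alice's qubits $1,\dots,m$ and Bob's $m+1,\dots,n$, so that qubits $k$ and $k+m$ form the $k$-th pair. Each player receives one question from $\{X,Z,D\}\cup\{X_j\}_j\cup\{Z_j\}_j$, where $j$ ranges over the digit positions of the binary representations of $1,\dots,m$ (there are as many positions as $m$ has binary digits). On question $X$, $Z$, $D$ the player measures all of their qubits in the eigenbasis of the Pauli matrix $X$, of $Z$, of $D=(X+Z)/\sqrt2$, respectively. On question $X_j$ the qubit of pair $k$ is measured in the basis $X$ if the $j$-th binary digit of $k$ is $1$ and in the basis $Z$ otherwise; on question $Z_j$ it is measured in the basis $Z$ if the $j$-th digit of $k$ is $1$ and in the basis $X$ otherwise. Write $M^q_k$ for the resulting ideal observable on qubit $k$ $(1\le k\le n)$, and $X_k,Z_k$ for the Pauli operators on qubit $k$. **General behaviour.**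 Let $|\psi'\rangle$ be a unit vector in $\mathcal H_A\otimes\mathcal H_B$, with $\mathcal H_A,\mathcal H_B$ arbitrary complex Hilbert spaces. On question $q$ each player performs a complete projective measurement $\{\Pi^q_a\}$ on their own space, with outcomes $a\in\{-1,1\}^{m}$. For $1\le k\le m$ let $M'^q_k=\sum_{a:a_k=1}\Pi^q_a-\sum_{a:a_k=-1}\Pi^q_a$, formed from Alice's measurement and acting on $\mathcal H_A$, and let $M'^q_{k+m}$ be the same operator formed from Bob's measurement and acting on $\mathcal H_B$. Put $X'_k=M'^X_k$, $Z'_k=M'^Z_k$ for $1\le k\le n$. For $t\in\{0,1\}^n$ write $X'^t=\prod_{k=1}^n X_k'^{\,t_k}$ (index increasing from left to right), and similarly $Z'^t,X^t,Z^t$; $|t|$ is the Hamming weight of $t$. **Statement.** Each player has $2\lfloor\log_2 n\rfloor+3$ possible questions if $m\ge1$ (and $3$ if $m=0$). Let $\varepsilon$ be a real number such that, for all questions $q$ (for Alice) and $r$ (for Bob) of which at least one belongs to $\{X,Z\}$, and for all $1\le k\le m$, $$\bigl|\langle\psi'|M'^q_kM'^r_{k+m}|\psi'\rangle-\langle\psi|M^q_kM^r_{k+m}|\psi\rangle\bigr|\le\varepsilon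 .$$ Then there are a Hilbert space $\mathcal K$, a linear isometry $\Phi:\mathcal H_A\otimes\mathcal H_B\to\mathcal K\otimes(\mathbb C^2)^{\otimes n}$ and a unit vector $|junk\rangle\in\mathcal K$ such that for all $p,q\in\{0,1\}^n$ $$\bigl\|\Phi(X'^qZ'^p|\psi'\rangle)-|junk\rangle\otimes X^qZ^p|\psi\rangle\bigr\|\le\sqrt{\sqrt{2\varepsilon}\Bigl(\tfrac{9n^2}{4}+\tfrac{3n}{2}\Bigr)+\tfrac{n\varepsilon_4}{2}}+\sqrt{\sqrt{2\varepsilon}\Bigl[\tfrac{9n^2}{8}+n\Bigl(\tfrac{5|p|}{2}-\tfrac14\Bigr)-\tfrac{|p|}{2}\Bigr]+\varepsilon_4\Bigl(\tfrac n4+\tfrac{|p|}{2}\Bigr)},$$ where $\varepsilon_4=4(1+\sqrt2)(2\varepsilon)^{1/4}+8\sqrt{2\varepsilon}+(5+3\sqrt2)(2\varepsilon)^{3/4}$. (For $m=0$ a negative $\varepsilon$ is allowed; the bound is then read as $0$.) -/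

import Mathlib

open scoped TensorProduct

universe u v

noncomputable section

namespace ParallelMayersYao

/-! ### Bit strings and products of operators

For `m` e-bits there are `n = 2 * m` sites: `Sum.inl k` is Alice's site for e-bit `k`, and
`Sum.inr k` is Bob's. In the usual numbering `1, …, n` Alice has the first half. -/

/-- The `2 * m` sites: Alice's `m` sites, followed by Bob's `m` sites. -/
abbrev Site (m : ℕ) : Type := Fin m ⊕ Fin m

/-- Bit strings of length `n = 2 * m`. -/
abbrev BitString (m : ℕ) : Type := Site m → Fin 2

/-- `T ^ t = ∏ₖ Tₖ ^ tₖ`, where the site index increases from left to right. -/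
def bitPow {R : Type*} [Monoid R] {m : ℕ} (T : Site m → R) (t : BitString m) : R :=
  (List.ofFn fun k : Fin m => T (Sum.inl k) ^ (t (Sum.inl k)).val).prod *
    (List.ofFn fun k : Fin m => T (Sum.inr k) ^ (t (Sum.inr k)).val).prod

/-! ### The questions and the honest behaviour -/

/-- The questions that a player may get in the test of `m` e-bits. `Nat.size m` is the number of
binary digits of `m`, so `j` runs over the digit positions of the numbers `1, …, m`. -/
inductive Question (m : ℕ) : Type
  | X : Question m
  | Z : Question m
  | D : Question m
  | Xbit (j : Fin (Nat.size m)) : Question m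
  | Zbit (j : Fin (Nat.size m)) : Question m

/-- The questions `X` and `Z`. -/
def Question.IsXZ {m : ℕ} (q : Question m) : Prop := q = Question.X ∨ q = Question.Z

/-- The Pauli matrix `X`. -/
def pauliX : Matrix (Fin 2) (Fin 2) ℂ := !![0, 1; 1, 0]

/-- The Pauli matrix `Z`. -/
def pauliZ : Matrix (Fin 2) (Fin 2) ℂ := !![1, 0; 0, -1]

/-- `D = (X + Z) / √2`. -/
def pauliD : Matrix (Fin 2) (Fin 2) ℂ := ((1 / Real.sqrt 2 : ℝ) : ℂ) • (pauliX + pauliZ)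

/-- The single-qubit observable that an honest player measures on the qubit of e-bit `k` on
question `q`. The e-bits carry the labels `1, …, m`, so `k : Fin m` has the label `k + 1`. -/
def honestMatrix {m : ℕ} (q : Question m) (k : Fin m) : Matrix (Fin 2) (Fin 2) ℂ :=
  match q with
  | .X => pauliX
  | .Z => pauliZ
  | .D => pauliD
  | .Xbit j => if (k.val + 1).testBit j.val then pauliX else pauliZ
  | .Zbit j => if (k.val + 1).testBit j.val then pauliZ else pauliX

/-- The space of `n = 2 * m` qubits, with the computational basis indexed by bit strings. -/
abbrev Qubits (m : ℕ) : Type := EuclideanSpace ℂ (BitString m)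

/-- The operator that acts as `U` on the qubit at site `k` and as the identity elsewhere. -/
def onSite {m : ℕ} (U : Matrix (Fin 2) (Fin 2) ℂ) (k : Site m) : Qubits m →L[ℂ] Qubits m :=
  Matrix.toEuclideanCLM (𝕜 := ℂ) (n := BitString m)
    (Matrix.of fun s t => if ∀ l, l ≠ k → s l = t l then U (s k) (t k) else 0)

/-- The ideal observables `M^q_k`. -/
def idealObs {m : ℕ} (q : Question m) : Site m → (Qubits m →L[ℂ] Qubits m)
  | Sum.inl k => onSite (honestMatrix q k) (Sum.inl k)
  | Sum.inr k => onSite (honestMatrix q k) (Sum.inr k)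

/-- The ideal state: `m` copies of `(|00⟩ + |01⟩ + |10⟩ - |11⟩) / 2`, where the `k`-th copy lives
on the sites `Sum.inl k` and `Sum.inr k`. -/
def idealState (m : ℕ) : Qubits m :=
  WithLp.toLp 2 fun u : BitString m =>
    ∏ k : Fin m, (if u (Sum.inl k) = 1 ∧ u (Sum.inr k) = 1 then (-1 / 2 : ℂ) else 1 / 2)

/-! ### General behaviour of the players -/

/-- A (complete) projective measurement on `H` with outcomes in `ι`. -/
structure ProjMeas (H : Type*) [NormedAddCommGroup H] [InnerProductSpace ℂ H] [CompleteSpace H]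
    (ι : Type*) [Fintype ι] [DecidableEq ι] where
  proj : ι → (H →L[ℂ] H)
  isSelfAdjoint : ∀ a, IsSelfAdjoint (proj a)
  mul_proj : ∀ a b, proj a * proj b = if a = b then proj a else 0
  sum_proj : ∑ a, proj a = 1

/-- An answer is a string of `m` signs `±1` (the units of `ℤ`). -/
abbrev Answer (m : ℕ) : Type := Fin m → ℤˣ

/-- The projector onto the answers whose `k`-th symbol is `x`. -/
def ProjMeas.symbolProj {H : Type*} [NormedAddCommGroup H] [InnerProductSpace ℂ H]
    [CompleteSpace H] {m : ℕ} (P : ProjMeas H (Answer m)) (k : Fin m) (x : ℤˣ) : H →L[ℂ] H :=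
  ∑ a : Answer m with a k = x, P.proj a

/-- The `±1`-valued observable of the `k`-th answer symbol. -/
def ProjMeas.obs {H : Type*} [NormedAddCommGroup H] [InnerProductSpace ℂ H]
    [CompleteSpace H] {m : ℕ} (P : ProjMeas H (Answer m)) (k : Fin m) : H →L[ℂ] H :=
  P.symbolProj k 1 - P.symbolProj k (-1)

/-- The Hilbert space tensor product of the players' systems. -/
abbrev Joint (HA HB : Type*) [NormedAddCommGroup HA] [InnerProductSpace ℂ HA]
    [NormedAddCommGroup HB] [InnerProductSpace ℂ HB] : Type _ :=
  UniformSpace.Completion (HA ⊗[ℂ] HB)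

/-- The observables `M'^q_k` of the players on the joint system: `M ⊗ 1` for Alice's sites and
`1 ⊗ M` for Bob's sites, where `A q` and `B q` are the measurements of Alice and Bob on
question `q`. -/
def jointObs {HA HB : Type*} [NormedAddCommGroup HA] [InnerProductSpace ℂ HA] [CompleteSpace HA]
    [NormedAddCommGroup HB] [InnerProductSpace ℂ HB] [CompleteSpace HB] {m : ℕ}
    (A : Question m → ProjMeas HA (Answer m)) (B : Question m → ProjMeas HB (Answer m))
    (q : Question m) : Site m → (Joint HA HB →L[ℂ] Joint HA HB)
  | Sum.inl k => (((A q).obs k).rTensor HB).completion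
  | Sum.inr k => (((B q).obs k).lTensor HA).completion

/-- The anticommutation error
`ε₄ = 4 (1 + √2) (2ε)^(1/4) + 8 √(2ε) + (5 + 3 √2) (2ε)^(3/4)`. -/
def eps4 (ε : ℝ) : ℝ :=
  4 * (1 + Real.sqrt 2) * (2 * ε) ^ (1 / 4 : ℝ) + 8 * Real.sqrt (2 * ε)
    + (5 + 3 * Real.sqrt 2) * (2 * ε) ^ (3 / 4 : ℝ)

/-- The robustness bound for `n` qubits and a `Z`-exponent of Hamming weight `w`. -/
def robustnessBound (n w ε : ℝ) : ℝ :=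
  Real.sqrt (Real.sqrt (2 * ε) * (9 * n ^ 2 / 4 + 3 * n / 2) + n * eps4 ε / 2)
    + Real.sqrt (Real.sqrt (2 * ε) * (9 * n ^ 2 / 8 + n * (5 * w / 2 - 1 / 4) - w / 2)
        + eps4 ε * (n / 4 + w / 2))

end ParallelMayersYao

end

open ParallelMayersYao

/-!
The players' operators `X k` and `Z k` are reflections; those for one question commute, and so do
those of different players. Closeness of the correlations to the ideal ones makes them satisfy,
on the shared vector `ψ`, three kinds of approximate relations (`CorrClose.approxPauli`). With
`δ = √(2 * ε)`: `X k ψ` and `Z k' ψ` are `δ`-close for the partner site `k'` of `k` (a stabilizer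
relation of the ideal state); `X k` and `Z l` commute up to `4 * δ` for `k ≠ l`, since some bit
question of the other player has both partner observables measured jointly; and `X k`, `Z k`
anticommute up to `antiErr`, about half of `ε₄`, since `D` at the partner site acts on `ψ` almost
as `(X k + Z k) / √2` and squares to `1`.

The stabilizer relation allows operators next to `ψ` to be replaced by operators of the other
player, which commute with everything at hand. So the relations propagate to the products
`X ^ q` and `Z ^ t` with an error that is linear in the weight of `t`
(`ApproxPauli.norm_bitPow_comm_le`).

The isometry is the swap isometry `v ↦ ∑ₛ X ^ s Πₛ v ⊗ |s⟩`, with `Πₛ` the joint spectral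
projections of the `Z k`. It intertwines `Z ^ p` exactly. By Parseval's identity on the group of
bit strings, its failure to intertwine `X ^ q` is the mean square over `t` of the commutation error
of `X ^ q` and `Z ^ t` (`ApproxPauli.sum_swapComp_sub_sq_le`). Likewise, Poincaré's inequality on
the discrete cube shows that the components of the image of `ψ`, with the signs of the ideal
state removed, are close to their mean, whose direction is the junk vector
(`ApproxPauli.exists_junk`).

These two estimates give an error that is linear in `ε₄`, up to terms of order `δ`, whereas the
stated bound is a sum of two square roots. As long as that bound is below the trivial bound `2`,
it exceeds half of its square, and this exceeds the linear error (`min_le_robustnessBound`).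
-/

noncomputable section

namespace ParallelMayersYao

/-! ### Characters of the group of bit strings -/

/-- The character `χ(s, t) = (-1) ^ (s · t)` of the group of bit strings. -/
def chi {m : ℕ} (s t : BitString m) : ℂ := ∏ k, if s k = 1 ∧ t k = 1 then -1 else 1

section Characters

variable {m : ℕ}

theorem bitString_add_self (s : BitString m) : s + s = 0 := by
  funext k
  have : ∀ a : Fin 2, a + a = 0 := by decide
  exact this (s k)

theorem bitString_add_cancel (s t : BitString m) : s + t + t = s := by
  rw [add_assoc, bitString_add_self, add_zero]

theorem chi_comm (s t : BitString m) : chi s t = chi t s := by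
  simp only [chi, and_comm]

theorem chi_add_right (s t u : BitString m) : chi s (t + u) = chi s t * chi s u := by
  unfold chi
  rw [← Finset.prod_mul_distrib]
  refine Finset.prod_congr rfl fun k _ => ?_
  have : ∀ a b c : Fin 2, (if a = 1 ∧ b + c = 1 then (-1 : ℂ) else 1)
      = (if a = 1 ∧ b = 1 then -1 else 1) * (if a = 1 ∧ c = 1 then -1 else 1) := by
    intro a b c
    fin_cases a <;> fin_cases b <;> fin_cases c <;> simp
  exact this _ _ _

theorem chi_add_left (s t u : BitString m) : chi (s + t) u = chi s u * chi t u := by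
  rw [chi_comm, chi_add_right, chi_comm u s, chi_comm u t]

@[simp] theorem chi_zero_right (s : BitString m) : chi s 0 = 1 := by simp [chi]

@[simp] theorem chi_zero_left (s : BitString m) : chi 0 s = 1 := by simp [chi]

@[simp] theorem chi_mul_self (s t : BitString m) : chi s t * chi s t = 1 := by
  rw [← chi_add_right, bitString_add_self, chi_zero_right]

@[simp] theorem norm_chi (s t : BitString m) : ‖chi s t‖ = 1 := by
  have h := congrArg norm (chi_mul_self s t)
  rw [norm_mul, norm_one] at h
  nlinarith [norm_nonneg (chi s t)]

@[simp] theorem conj_chi (s t : BitString m) : (starRingEnd ℂ) (chi s t) = chi s t := by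
  unfold chi
  rw [map_prod]
  refine Finset.prod_congr rfl fun k _ => ?_
  split_ifs <;> simp

theorem chi_single_left (k : Site m) (t : BitString m) :
    chi (Pi.single k 1) t = if t k = 1 then -1 else 1 := by
  unfold chi
  rw [Finset.prod_eq_single k]
  · simp
  · intro l _ hl
    simp [Pi.single_eq_of_ne hl]
  · simp

theorem chi_single_right (k : Site m) (t : BitString m) :
    chi t (Pi.single k 1) = if t k = 1 then -1 else 1 := by
  rw [chi_comm, chi_single_left]

theorem fin_two_ne_one {a : Fin 2} (h : a ≠ 0) : a = 1 := by
  revert a; decide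

theorem exists_eq_one_of_ne_zero {s : BitString m} (h : s ≠ 0) : ∃ k, s k = 1 := by
  obtain ⟨k, hk⟩ := Function.ne_iff.1 h
  exact ⟨k, fin_two_ne_one hk⟩

/-- Sums over all bit strings are invariant under translations. -/
theorem sum_add_right {M : Type*} [AddCommMonoid M] (f : BitString m → M) (u : BitString m) :
    ∑ s, f (s + u) = ∑ s, f s :=
  Equiv.sum_comp (Equiv.addRight u) f

theorem sum_chi (u : BitString m) :
    ∑ s : BitString m, chi s u = if u = 0 then (Fintype.card (BitString m) : ℂ) else 0 := by
  split_ifs with h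
  · simp [h]
  · obtain ⟨k, hk⟩ := exists_eq_one_of_ne_zero h
    have h1 := sum_add_right (fun s => chi s u) (Pi.single k 1)
    simp only [chi_add_left, chi_single_left, hk, if_true, mul_neg, mul_one,
      Finset.sum_neg_distrib] at h1
    exact self_eq_neg.1 h1.symm

variable {V : Type*} [NormedAddCommGroup V] [InnerProductSpace ℂ V]

/-- Parseval's identity on the group of bit strings, for vector-valued functions. -/
theorem sum_norm_sq_sum_chi_smul (v : BitString m → V) :
    ∑ s, ‖∑ t, chi s t • v t‖ ^ 2 = Fintype.card (BitString m) * ∑ t, ‖v t‖ ^ 2 := by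
  have key : ∑ s, inner ℂ (∑ t, chi s t • v t) (∑ t, chi s t • v t)
      = Fintype.card (BitString m) * ∑ t, inner ℂ (v t) (v t) := by
    calc ∑ s, inner ℂ (∑ t, chi s t • v t) (∑ t, chi s t • v t)
        = ∑ s, ∑ t, ∑ t', chi s (t + t') * inner ℂ (v t) (v t') := by
          refine Finset.sum_congr rfl fun s _ => ?_
          rw [sum_inner]
          refine Finset.sum_congr rfl fun t _ => ?_
          rw [inner_sum]
          refine Finset.sum_congr rfl fun t' _ => ?_
          rw [inner_smul_left, inner_smul_right, conj_chi, chi_add_right, mul_assoc]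
      _ = ∑ t, ∑ t', (∑ s, chi s (t + t')) * inner ℂ (v t) (v t') := by
          rw [Finset.sum_comm]
          refine Finset.sum_congr rfl fun t _ => ?_
          rw [Finset.sum_comm]
          refine Finset.sum_congr rfl fun t' _ => ?_
          rw [Finset.sum_mul]
      _ = ∑ t, (Fintype.card (BitString m) : ℂ) * inner ℂ (v t) (v t) := by
          refine Finset.sum_congr rfl fun t _ => ?_
          rw [Finset.sum_eq_single t]
          · rw [sum_chi, bitString_add_self, if_pos rfl]
          · intro t' _ ht'
            rw [sum_chi, if_neg, zero_mul]
            intro h0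
            apply ht'
            have := bitString_add_cancel t' t
            rwa [add_comm t' t, h0, zero_add, eq_comm] at this
          · simp
      _ = _ := by rw [Finset.mul_sum]
  have hre := congrArg Complex.re key
  simp only [Complex.re_sum, Complex.mul_re, Complex.natCast_re, Complex.natCast_im, zero_mul,
    sub_zero] at hre
  simpa only [norm_sq_eq_re_inner (𝕜 := ℂ), RCLike.re_to_complex] using hre

theorem card_bitString_pos : (0 : ℝ) < (Fintype.card (BitString m) : ℝ) :=
  Nat.cast_pos.2 Fintype.card_pos

/-- Poincaré's inequality on the discrete cube: the variance of a vector-valued function is at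
most a quarter of the total mean square of its discrete derivatives. -/
theorem sum_norm_sq_sub_le (g : BitString m → V) :
    ∑ s, ‖g s‖ ^ 2 - ‖∑ s, g s‖ ^ 2 / Fintype.card (BitString m)
      ≤ 1 / 4 * ∑ k, ∑ s, ‖g s - g (s + Pi.single k 1)‖ ^ 2 := by
  set N : ℝ := (Fintype.card (BitString m) : ℝ) with hN
  have hNpos : 0 < N := card_bitString_pos
  -- `h a` is the Fourier coefficient of `g` at `a`, up to normalization
  set h : BitString m → V := fun a => ∑ s, chi a s • g s with hh
  have hpar : ∑ a, ‖h a‖ ^ 2 = N * ∑ s, ‖g s‖ ^ 2 := sum_norm_sq_sum_chi_smul g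
  have hder : ∀ k : Site m, N * ∑ s, ‖g s - g (s + Pi.single k 1)‖ ^ 2
      = ∑ a : BitString m, if a k = 1 then 4 * ‖h a‖ ^ 2 else 0 := by
    intro k
    rw [hN, ← sum_norm_sq_sum_chi_smul]
    refine Finset.sum_congr rfl fun a _ => ?_
    have h1 : ∑ t, chi a t • g (t + Pi.single k 1) = chi a (Pi.single k 1) • h a := by
      rw [hh, Finset.smul_sum,
        ← sum_add_right (fun s => chi a (Pi.single k 1) • chi a s • g s) (Pi.single k 1)]
      refine Finset.sum_congr rfl fun s _ => ?_
      rw [smul_smul, chi_add_right, mul_left_comm, chi_mul_self, mul_one]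
    simp only [smul_sub, Finset.sum_sub_distrib, h1]
    rw [chi_single_right]
    split_ifs with hk
    · rw [neg_one_smul, sub_neg_eq_add]
      change ‖h a + h a‖ ^ 2 = _
      rw [← two_smul ℂ (h a), norm_smul, mul_pow]
      norm_num
    · simp [hh]
  have h0 : h 0 = ∑ s, g s := by simp [hh]
  have hge : ∑ a, ‖h a‖ ^ 2 - ‖h 0‖ ^ 2
      ≤ 1 / 4 * ∑ k : Site m, ∑ a : BitString m, if a k = 1 then 4 * ‖h a‖ ^ 2 else 0 := by
    rw [Finset.sum_comm, ← Finset.add_sum_erase _ _ (Finset.mem_univ (0 : BitString m)),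
      add_sub_cancel_left, Finset.mul_sum]
    refine (Finset.sum_le_sum fun a ha => ?_).trans
      (Finset.sum_le_sum_of_subset_of_nonneg (Finset.erase_subset 0 Finset.univ) ?_)
    · obtain ⟨k, hk⟩ := exists_eq_one_of_ne_zero (Finset.ne_of_mem_erase ha)
      have := Finset.single_le_sum (f := fun k : Site m => if a k = 1 then 4 * ‖h a‖ ^ 2 else 0)
        (fun l _ => by split_ifs <;> positivity) (Finset.mem_univ k)
      simp only [hk, if_true] at this
      linarith
    · intro a _ _
      refine mul_nonneg (by norm_num) (Finset.sum_nonneg fun k _ => ?_)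
      split_ifs <;> positivity
  rw [hpar, h0] at hge
  simp only [← hder, ← Finset.mul_sum] at hge
  have h2 : N * (∑ s, ‖g s‖ ^ 2 - ‖∑ s, g s‖ ^ 2 / N)
      ≤ N * (1 / 4 * ∑ k, ∑ s, ‖g s - g (s + Pi.single k 1)‖ ^ 2) := by
    rw [mul_sub, mul_div_cancel₀ _ hNpos.ne']
    linarith
  exact le_of_mul_le_mul_left h2 hNpos

/-- On average, half of the bits of a bit string are set. -/
theorem sum_hammingNorm :
    ∑ t : BitString m, (hammingNorm t : ℝ) = m * Fintype.card (BitString m) := by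
  -- complementing all bits exchanges weight `w` and `2 * m - w`
  have h1 := sum_add_right (fun t : BitString m => (hammingNorm t : ℝ)) (fun _ => 1)
  have h2 : ∀ t : BitString m,
      (hammingNorm (t + fun _ => 1) : ℝ) = 2 * m - hammingNorm t := by
    intro t
    have hc := Finset.card_filter_add_card_filter_not (s := (Finset.univ : Finset (Site m)))
      (fun k => t k ≠ 0)
    have e : hammingNorm (t + fun _ => 1) = (Finset.univ.filter fun k => ¬ t k ≠ 0).card := by
      unfold hammingNorm
      congr 1
      ext k
      have : ∀ a : Fin 2, a + 1 ≠ 0 ↔ ¬ a ≠ 0 := by decide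
      simpa using this (t k)
    have hn : hammingNorm t = (Finset.univ.filter fun k => t k ≠ 0).card := rfl
    have hs : (Finset.univ : Finset (Site m)).card = 2 * m := by
      simp [two_mul]
    rw [← hn, ← e, hs] at hc
    have : (hammingNorm t : ℝ) + hammingNorm (t + fun _ => 1) = 2 * m := by exact_mod_cast hc
    linarith
  simp only [h2, Finset.sum_sub_distrib, Finset.sum_const, Finset.card_univ, nsmul_eq_mul] at h1
  linarith

theorem hammingNorm_le (t : BitString m) : hammingNorm t ≤ 2 * m := by
  refine (hammingNorm_le_card_fintype).trans ?_
  simp [two_mul]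

end Characters

/-! ### Products of operators along bit strings -/

section BitPow

variable {R : Type*} [Monoid R] {m : ℕ}

theorem prod_ofFn_mul_of_commute :
    ∀ {r : ℕ} (f g : Fin r → R), (∀ i j, Commute (f i) (g j)) →
      (List.ofFn fun i => f i * g i).prod = (List.ofFn f).prod * (List.ofFn g).prod
  | 0, _, _, _ => by simp
  | r + 1, f, g, h => by
    have hc : Commute (List.ofFn fun i : Fin r => f i.succ).prod (g 0) := by
      refine Commute.list_prod_left _ _ fun x hx => ?_
      obtain ⟨i, rfl⟩ := (List.mem_ofFn' _ _).1 hx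
      exact h _ _
    simp only [List.ofFn_succ, List.prod_cons]
    rw [prod_ofFn_mul_of_commute _ _ fun i j => h i.succ j.succ]
    simp only [mul_assoc]
    rw [← mul_assoc (g 0), ← hc.eq, mul_assoc]

theorem prod_ofFn_eq_single :
    ∀ {r : ℕ} (f : Fin r → R) (k : Fin r), (∀ i, i ≠ k → f i = 1) → (List.ofFn f).prod = f k
  | 0, _, k, _ => k.elim0
  | r + 1, f, k, h => by
    rw [List.ofFn_succ, List.prod_cons]
    induction k using Fin.cases with
    | zero =>
      have : (fun i : Fin r => f i.succ) = fun _ => 1 :=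
        funext fun i => h _ (Fin.succ_ne_zero i)
      simp [this]
    | succ k =>
      rw [h 0 (Fin.succ_ne_zero k).symm, one_mul]
      exact prod_ofFn_eq_single (fun i => f i.succ) k
        fun i hi => h _ fun e => hi (Fin.succ_injective _ e)

theorem bitPow_zero (T : Site m → R) : bitPow T 0 = 1 := by
  simp [bitPow]

theorem bitPow_single (T : Site m → R) (k : Site m) : bitPow T (Pi.single k 1) = T k := by
  unfold bitPow
  rcases k with k | k
  · rw [prod_ofFn_eq_single _ k fun i hi => by
      rw [Pi.single_eq_of_ne (by simpa using hi)]; simp]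
    simp
  · rw [prod_ofFn_eq_single (fun i => T (Sum.inr i) ^ _) k fun i hi => by
      rw [Pi.single_eq_of_ne (by simpa using hi)]; simp]
    simp

theorem commute_bitPow {a : R} {T : Site m → R} {t : BitString m}
    (h : ∀ k, t k ≠ 0 → Commute a (T k)) : Commute a (bitPow T t) := by
  have hk : ∀ k, Commute a (T k ^ (t k).val) := by
    intro k
    by_cases h0 : t k = 0
    · simp [h0]
    · exact (h k h0).pow_right _
  refine Commute.mul_right ?_ ?_ <;>
  · refine Commute.list_prod_right _ _ fun x hx => ?_
    obtain ⟨i, rfl⟩ := (List.mem_ofFn' _ _).1 hx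
    exact hk _

/-- A commuting family of involutions generates a representation of the group of bit strings. -/
theorem bitPow_add {T : Site m → R} (h2 : ∀ k, T k * T k = 1) (hc : ∀ k l, Commute (T k) (T l))
    (s t : BitString m) : bitPow T (s + t) = bitPow T s * bitPow T t := by
  have hk : ∀ k, T k ^ ((s + t) k).val = T k ^ (s k).val * T k ^ (t k).val := by
    intro k
    have : ∀ a b : Fin 2, T k ^ (a + b).val = T k ^ a.val * T k ^ b.val := by
      intro a b
      fin_cases a <;> fin_cases b <;> simp [h2]
    exact this _ _
  have hcomm : Commute (List.ofFn fun k : Fin m => T (Sum.inr k) ^ (s (Sum.inr k)).val).prod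
      (List.ofFn fun k : Fin m => T (Sum.inl k) ^ (t (Sum.inl k)).val).prod := by
    refine Commute.list_prod_left _ _ fun x hx => Commute.list_prod_right _ _ fun y hy => ?_
    obtain ⟨i, rfl⟩ := (List.mem_ofFn' _ _).1 hx
    obtain ⟨j, rfl⟩ := (List.mem_ofFn' _ _).1 hy
    exact (hc _ _).pow_pow _ _
  unfold bitPow
  simp only [hk]
  rw [prod_ofFn_mul_of_commute _ _ fun i j => (hc _ _).pow_pow _ _,
    prod_ofFn_mul_of_commute _ _ fun i j => (hc _ _).pow_pow _ _]
  simp only [mul_assoc]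
  rw [← mul_assoc _ _ (List.prod _), ← hcomm.eq]
  simp only [mul_assoc]

theorem bitPow_eq_hom {T : Site m → R} (Ψ : Multiplicative (BitString m) →* R)
    (h : ∀ k, Ψ (Multiplicative.ofAdd (Pi.single k 1)) = T k) (t : BitString m) :
    bitPow T t = Ψ (Multiplicative.ofAdd t) := by
  have hk : ∀ k, T k ^ (t k).val = Ψ (Multiplicative.ofAdd (Pi.single k (t k))) := by
    intro k
    have : ∀ a : Fin 2, T k ^ a.val = Ψ (Multiplicative.ofAdd (Pi.single k a)) := by
      intro a
      fin_cases a
      · simp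
      · simpa using (h k).symm
    exact this _
  have ht : t = ∑ k, Pi.single k (t k) := (Finset.univ_sum_single t).symm
  have hp : ∀ f : Fin m → Site m, (List.ofFn fun i => T (f i) ^ (t (f i)).val).prod
      = Ψ (Multiplicative.ofAdd (∑ i, Pi.single (f i) (t (f i)))) := by
    intro f
    simp only [hk]
    rw [ofAdd_sum, ← List.prod_ofFn, map_list_prod, List.map_ofFn]
    rfl
  unfold bitPow
  rw [hp, hp, ← map_mul, ← ofAdd_add]
  conv_rhs => rw [ht, Fintype.sum_sum_type]

end BitPow

/-- A commuting family of symmetric involutions (hence of unitaries), one for each site. -/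
structure IsReflectionFamily {V : Type*} [NormedAddCommGroup V] [InnerProductSpace ℂ V] {m : ℕ}
    (T : Site m → V →L[ℂ] V) : Prop where
  symm : ∀ k x y, inner ℂ (T k x) y = inner ℂ x (T k y)
  mul_self : ∀ k, T k * T k = 1
  comm : ∀ k l, Commute (T k) (T l)

section Reflections

variable {V : Type*} [NormedAddCommGroup V] [InnerProductSpace ℂ V] {m : ℕ}

theorem commute_apply {S T : V →L[ℂ] V} (h : Commute S T) (v : V) : S (T v) = T (S v) :=
  DFunLike.congr_fun h.eq v

theorem norm_apply_of_reflection {T : V →L[ℂ] V} (hs : ∀ x y, inner ℂ (T x) y = inner ℂ x (T y))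
    (h2 : T * T = 1) (v : V) : ‖T v‖ = ‖v‖ := by
  have h : T (T v) = v := DFunLike.congr_fun h2 v
  have h1 : ‖T v‖ ^ 2 = ‖v‖ ^ 2 := by
    rw [norm_sq_eq_re_inner (𝕜 := ℂ), hs, h, ← norm_sq_eq_re_inner]
  exact (sq_eq_sq₀ (norm_nonneg _) (norm_nonneg _)).1 h1

namespace IsReflectionFamily

variable {T : Site m → V →L[ℂ] V} (hT : IsReflectionFamily T)

include hT

theorem norm_apply (k : Site m) (v : V) : ‖T k v‖ = ‖v‖ :=
  norm_apply_of_reflection (hT.symm k) (hT.mul_self k) v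

theorem bitPow_add_apply (s t : BitString m) (v : V) :
    bitPow T (s + t) v = bitPow T s (bitPow T t v) := by
  rw [bitPow_add hT.mul_self hT.comm]; rfl

theorem bitPow_comm (s t : BitString m) : Commute (bitPow T s) (bitPow T t) := by
  rw [Commute, SemiconjBy, ← bitPow_add hT.mul_self hT.comm, add_comm,
    bitPow_add hT.mul_self hT.comm]

theorem norm_bitPow_apply (t : BitString m) (v : V) : ‖bitPow T t v‖ = ‖v‖ := by
  have hk : ∀ (k : Site m) (a : ℕ) (v : V), ‖(T k ^ a) v‖ = ‖v‖ := by
    intro k a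
    induction a with
    | zero => simp
    | succ a ih => intro v; rw [pow_succ, mul_apply_eq_comp, ih, hT.norm_apply]
  have hl : ∀ (L : List (V →L[ℂ] V)), (∀ S ∈ L, ∀ v, ‖S v‖ = ‖v‖) → ∀ v, ‖L.prod v‖ = ‖v‖ := by
    intro L
    induction L with
    | nil => simp
    | cons S L ih =>
      intro h v
      rw [List.prod_cons, mul_apply_eq_comp, h S (by simp),
        ih fun S' hS' => h S' (by simp [hS'])]
  unfold bitPow
  rw [mul_apply_eq_comp, hl, hl] <;>
  · intro S hS
    obtain ⟨i, rfl⟩ := (List.mem_ofFn' _ _).1 hS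
    exact hk _ _

end IsReflectionFamily

end Reflections

/-! ### Approximate Pauli relations and their propagation to products -/

/-- The operators `X k` and `Z k` satisfy, on the vector `ψ`, the Pauli relations and the
stabilizer relations of the ideal state up to errors: `δ` for the stabilizer relation between
a site and its partner `k.swap`, `η` for the anticommutation at a site, and `4 * δ` for the
commutation at different sites. Operators of different players commute exactly. -/
structure ApproxPauli {V : Type*} [NormedAddCommGroup V] [InnerProductSpace ℂ V] {m : ℕ}
    (X Z : Site m → V →L[ℂ] V) (ψ : V) (δ η : ℝ) : Prop where
  reflX : IsReflectionFamily X
  reflZ : IsReflectionFamily Z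
  comm_of_ne : ∀ k l, k.isLeft ≠ l.isLeft → Commute (X k) (Z l)
  delta_nonneg : 0 ≤ δ
  eta_nonneg : 0 ≤ η
  stab : ∀ k, ‖X k ψ - Z k.swap ψ‖ ≤ δ
  anti : ∀ k, ‖X k (Z k ψ) + Z k (X k ψ)‖ ≤ η
  almost_comm : ∀ k l, k ≠ l → ‖X k (Z l ψ) - Z l (X k ψ)‖ ≤ 4 * δ

/-- The indicator of a set of sites, as a bit string. -/
def indBits {m : ℕ} (S : Finset (Site m)) : BitString m := fun k => if k ∈ S then 1 else 0

section Ind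

variable {m : ℕ}

theorem indBits_empty : indBits (∅ : Finset (Site m)) = 0 := by
  funext k; simp [indBits]

theorem indBits_insert {S : Finset (Site m)} {k : Site m} (hk : k ∉ S) :
    indBits (insert k S) = indBits S + Pi.single k 1 := by
  funext l
  by_cases h : l = k
  · subst h; simp [indBits, hk]
  · simp [indBits, h]

theorem indBits_filter_left_add_right (t : BitString m) :
    indBits (Finset.univ.filter fun k => t k ≠ 0 ∧ k.isLeft = true)
      + indBits (Finset.univ.filter fun k => t k ≠ 0 ∧ k.isLeft = false) = t := by
  funext k
  by_cases h : t k = 0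
  · simp [indBits, h]
  · rcases k with k | k <;> simp [indBits, h] <;> exact (fin_two_ne_one h).symm

theorem mem_of_indBits_ne_zero {S : Finset (Site m)} {k : Site m} (h : indBits S k ≠ 0) :
    k ∈ S := by
  by_contra hk
  simp [indBits, hk] at h

theorem chi_indBits_of_disjoint {S T : Finset (Site m)} (h : Disjoint S T) :
    chi (indBits S) (indBits T) = 1 := by
  refine Finset.prod_eq_one fun k _ => if_neg ?_
  rintro ⟨h1, h2⟩
  exact Finset.disjoint_left.1 h (mem_of_indBits_ne_zero (by rw [h1]; decide))
    (mem_of_indBits_ne_zero (by rw [h2]; decide))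

theorem isLeft_swap_ne (k : Site m) : k.swap.isLeft ≠ k.isLeft := by
  rcases k with k | k <;> simp

theorem card_filter_isLeft (a : Bool) :
    (Finset.univ.filter fun k : Site m => k.isLeft = a).card = m := by
  have e : (Finset.univ.filter fun k : Site m => k.isLeft = a)
      = if a then Finset.univ.map ⟨Sum.inl, Sum.inl_injective⟩
        else Finset.univ.map ⟨Sum.inr, Sum.inr_injective⟩ := by
    ext k
    rcases k with k | k <;> cases a <;> simp
  rw [e]
  cases a <;> simp

end Ind

namespace ApproxPauli

variable {V : Type*} [NormedAddCommGroup V] [InnerProductSpace ℂ V] {m : ℕ}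
  {X Z : Site m → V →L[ℂ] V} {ψ : V} {δ η : ℝ} (h : ApproxPauli X Z ψ δ η)

include h

theorem norm_single_le (k l : Site m) :
    ‖X k (Z l ψ) - chi (Pi.single k 1) (Pi.single l 1) • Z l (X k ψ)‖
      ≤ if k = l then η else 4 * δ := by
  rw [chi_single_left]
  by_cases hkl : k = l
  · subst hkl
    simpa [sub_neg_eq_add] using h.anti k
  · simpa [Pi.single_eq_of_ne hkl, hkl] using h.almost_comm k l hkl

/-- Moving `X ^ Q` through `Z l` costs one (anti)commutation error and two stabilizer errors for
each factor: on `ψ` the factor `X k` that has just been moved is replaced by `Z k.swap`, which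
belongs to the other player and is out of the way. -/
theorem norm_row_le {a : Bool} (l : Site m) (Q : Finset (Site m))
    (hQ : ∀ k ∈ Q, k.isLeft = a) :
    ‖bitPow X (indBits Q) (Z l ψ)
        - chi (indBits Q) (Pi.single l 1) • Z l (bitPow X (indBits Q) ψ)‖
      ≤ ∑ k ∈ Q, ((if k = l then η else 4 * δ) + 2 * δ) := by
  induction Q using Finset.induction_on with
  | empty => simp [indBits_empty, bitPow_zero]
  | insert k Q hk ih =>
    have ih := ih fun k' hk' => hQ k' (Finset.mem_insert_of_mem hk')
    rw [Finset.sum_insert hk, indBits_insert hk, chi_add_left, h.reflX.bitPow_add_apply,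
      h.reflX.bitPow_add_apply, bitPow_single]
    set F := bitPow X (indBits Q)
    set c := chi (indBits Q) (Pi.single l 1)
    set d := chi (Pi.single k 1) (Pi.single l 1)
    have hka : k.isLeft = a := hQ k (Finset.mem_insert_self k Q)
    have hZF : Commute (Z k.swap) F := by
      refine commute_bitPow fun k' hk' => (h.comm_of_ne _ _ ?_).symm
      have := hQ k' (Finset.mem_insert_of_mem (mem_of_indBits_ne_zero hk'))
      rw [this, ← hka]
      exact (isLeft_swap_ne k).symm
    have e : F (X k (Z l ψ)) - (c * d) • Z l (F (X k ψ))
        = F (X k (Z l ψ) - d • Z l (X k ψ)) + d • F (Z l (X k ψ - Z k.swap ψ))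
          + d • Z k.swap (F (Z l ψ) - c • Z l (F ψ))
          + (c * d) • Z l (F (Z k.swap ψ - X k ψ)) := by
      have e1 : F (Z l (Z k.swap ψ)) = Z k.swap (F (Z l ψ)) := by
        rw [commute_apply hZF, commute_apply (h.reflZ.comm l k.swap)]
      have e2 : Z l (F (Z k.swap ψ)) = Z k.swap (Z l (F ψ)) := by
        rw [← commute_apply hZF, commute_apply (h.reflZ.comm l k.swap)]
      simp only [map_sub, map_smul, smul_sub, smul_smul, e1, e2, mul_comm c d]
      abel
    have hF : ∀ v, ‖F v‖ = ‖v‖ := h.reflX.norm_bitPow_apply _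
    rw [e]
    refine (norm_add_le _ _).trans ?_
    refine (add_le_add (norm_add_le _ _) le_rfl).trans ?_
    refine (add_le_add (add_le_add (norm_add_le _ _) le_rfl) le_rfl).trans ?_
    rw [norm_smul, norm_smul, norm_smul, norm_mul, norm_chi, norm_chi]
    simp only [hF, h.reflZ.norm_apply, one_mul]
    have h1 := h.norm_single_le k l
    have h2 := h.stab k
    have h3 := h.stab k
    rw [norm_sub_rev] at h3
    linarith

theorem sum_row_le {a : Bool} {l : Site m} (hl : l.isLeft = a) {Q : Finset (Site m)}
    (hQ : ∀ k ∈ Q, k.isLeft = a) :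
    ∑ k ∈ Q, ((if k = l then η else 4 * δ) + 2 * δ) ≤ η + 2 * δ + 6 * δ * (m - 1) := by
  have hδ := h.delta_nonneg
  have hη := h.eta_nonneg
  have hsub : Q ⊆ Finset.univ.filter fun k : Site m => k.isLeft = a := fun k hk => by
    simpa using hQ k hk
  have hlm : l ∈ Finset.univ.filter fun k : Site m => k.isLeft = a := by simpa using hl
  refine (Finset.sum_le_sum_of_subset_of_nonneg hsub fun k _ _ => ?_).trans ?_
  · split_ifs <;> positivity
  · rw [← Finset.add_sum_erase _ _ hlm, if_pos rfl, Finset.sum_congr rfl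
      (g := fun _ => 4 * δ + 2 * δ) fun k hk => by rw [if_neg (Finset.ne_of_mem_erase hk)],
      Finset.sum_const, Finset.card_erase_of_mem hlm, card_filter_isLeft, nsmul_eq_mul]
    have hm : 1 ≤ m := by
      have := Finset.card_pos.2 ⟨l, hlm⟩
      rwa [card_filter_isLeft] at this
    rw [Nat.cast_sub hm]
    push_cast
    linarith

/-- The operators `X ^ Q` and `Z ^ S` of one player commute up to sign on `ψ`, up to an error
proportional to the number of factors of `Z ^ S`. Factors of `Z ^ S` are traded for operators of
the other player, so that the induction hypothesis always meets the vector `ψ`. -/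
theorem norm_side_le {a : Bool} (Q S : Finset (Site m)) (hQ : ∀ k ∈ Q, k.isLeft = a)
    (hS : ∀ k ∈ S, k.isLeft = a) :
    ‖bitPow X (indBits Q) (bitPow Z (indBits S) ψ)
        - chi (indBits Q) (indBits S) • bitPow Z (indBits S) (bitPow X (indBits Q) ψ)‖
      ≤ S.card * (η + 4 * δ + 6 * δ * (m - 1)) := by
  induction S using Finset.induction_on with
  | empty => simp [indBits_empty, bitPow_zero]
  | insert l S hl ih =>
    have ih := ih fun k' hk' => hS k' (Finset.mem_insert_of_mem hk')
    have hla : l.isLeft = a := hS l (Finset.mem_insert_self l S)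
    have hrow := (h.norm_row_le l Q hQ).trans (h.sum_row_le hla hQ)
    rw [Finset.card_insert_of_notMem hl, indBits_insert hl, chi_add_right,
      h.reflZ.bitPow_add_apply, h.reflZ.bitPow_add_apply, bitPow_single]
    set F := bitPow X (indBits Q) with hFdef
    set G := bitPow Z (indBits S)
    set c := chi (indBits Q) (indBits S)
    set d := chi (indBits Q) (Pi.single l 1)
    have hXG : Commute (X l.swap) G := by
      refine commute_bitPow fun k' hk' => h.comm_of_ne _ _ ?_
      rw [hS k' (Finset.mem_insert_of_mem (mem_of_indBits_ne_zero hk')), ← hla]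
      exact isLeft_swap_ne l
    have hXF : Commute (X l.swap) F := commute_bitPow fun k' _ => h.reflX.comm _ _
    have e : F (G (Z l ψ)) - (c * d) • G (Z l (F ψ))
        = F (G (Z l ψ - X l.swap ψ)) + X l.swap (F (G ψ) - c • G (F ψ))
          + c • G (F (X l.swap ψ - Z l ψ)) + c • G (F (Z l ψ) - d • Z l (F ψ)) := by
      have e1 : F (G (X l.swap ψ)) = X l.swap (F (G ψ)) := by
        rw [← commute_apply hXG, ← commute_apply hXF]
      have e2 : G (F (X l.swap ψ)) = X l.swap (G (F ψ)) := by
        rw [← commute_apply hXF, ← commute_apply hXG]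
      simp only [map_sub, map_smul, smul_sub, smul_smul, e1, e2]
      abel
    have hF : ∀ v, ‖F v‖ = ‖v‖ := h.reflX.norm_bitPow_apply _
    have hG : ∀ v, ‖G v‖ = ‖v‖ := h.reflZ.norm_bitPow_apply _
    rw [e]
    refine (norm_add_le _ _).trans ?_
    refine (add_le_add (norm_add_le _ _) le_rfl).trans ?_
    refine (add_le_add (add_le_add (norm_add_le _ _) le_rfl) le_rfl).trans ?_
    rw [norm_smul, norm_smul, norm_chi]
    simp only [hF, hG, h.reflX.norm_apply, one_mul]
    have h2 := h.stab l.swap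
    have h3 := h.stab l.swap
    rw [Sum.swap_swap] at h2 h3
    rw [norm_sub_rev] at h3
    push_cast
    linarith

/-- The operators `X ^ q` and `Z ^ t` commute up to the sign `χ(q, t)` on `ψ`, up to an error
proportional to the weight of `t`. -/
theorem norm_bitPow_comm_le (q t : BitString m) :
    ‖bitPow X q (bitPow Z t ψ) - chi q t • bitPow Z t (bitPow X q ψ)‖
      ≤ hammingNorm t * (η + 4 * δ + 6 * δ * (m - 1)) := by
  set QA := Finset.univ.filter fun k => q k ≠ 0 ∧ k.isLeft = true with hQA
  set QB := Finset.univ.filter fun k => q k ≠ 0 ∧ k.isLeft = false with hQB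
  set SA := Finset.univ.filter fun k => t k ≠ 0 ∧ k.isLeft = true with hSA
  set SB := Finset.univ.filter fun k => t k ≠ 0 ∧ k.isLeft = false with hSB
  have hqa : ∀ k ∈ QA, k.isLeft = true := fun k hk => by simp [hQA] at hk; simpa using hk.2
  have hqb : ∀ k ∈ QB, k.isLeft = false := fun k hk => by simp [hQB] at hk; simpa using hk.2
  have hsa : ∀ k ∈ SA, k.isLeft = true := fun k hk => by simp [hSA] at hk; simpa using hk.2
  have hsb : ∀ k ∈ SB, k.isLeft = false := fun k hk => by simp [hSB] at hk; simpa using hk.2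
  have hA := h.norm_side_le QA SA hqa hsa
  have hB := h.norm_side_le QB SB hqb hsb
  have hdisj : ∀ {S T : Finset (Site m)}, (∀ k ∈ S, k.isLeft = true) →
      (∀ k ∈ T, k.isLeft = false) → Disjoint S T := by
    intro S T hS hT
    refine Finset.disjoint_left.2 fun k h1 h2 => ?_
    have := hS k h1
    rw [hT k h2] at this
    exact Bool.false_ne_true this
  have hcard : (hammingNorm t : ℝ) = SA.card + SB.card := by
    have : SA ∪ SB = Finset.univ.filter fun k => t k ≠ 0 := by
      ext k
      rcases k with k | k <;> simp [hSA, hSB]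
    rw [← Nat.cast_add, ← Finset.card_union_of_disjoint (hdisj hsa hsb), this]
    rfl
  have hchi : chi q t = chi (indBits QA) (indBits SA) * chi (indBits QB) (indBits SB) := by
    rw [← indBits_filter_left_add_right q, ← indBits_filter_left_add_right t]
    simp only [chi_add_left, chi_add_right, ← hQA, ← hQB, ← hSA, ← hSB,
      chi_indBits_of_disjoint (hdisj hqa hsb), chi_indBits_of_disjoint (hdisj hsa hqb).symm]
    ring
  have hq : q = indBits QA + indBits QB := (indBits_filter_left_add_right q).symm
  have ht : t = indBits SA + indBits SB := (indBits_filter_left_add_right t).symm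
  have hXZ : ∀ {a b : Bool} {Q S : Finset (Site m)}, a ≠ b → (∀ k ∈ Q, k.isLeft = a) →
      (∀ k ∈ S, k.isLeft = b) → Commute (bitPow X (indBits Q)) (bitPow Z (indBits S)) := by
    intro a b Q S hab hQ hS
    refine commute_bitPow fun k hk => (commute_bitPow fun l hl => ?_).symm
    refine (h.comm_of_ne _ _ ?_).symm
    rwa [hS _ (mem_of_indBits_ne_zero hk), hQ _ (mem_of_indBits_ne_zero hl)]
  have hAB : Commute (bitPow X (indBits QA)) (bitPow Z (indBits SB)) := hXZ (by decide) hqa hsb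
  have hBA : Commute (bitPow X (indBits QB)) (bitPow Z (indBits SA)) := hXZ (by decide) hqb hsa
  have hXX := h.reflX.bitPow_comm (indBits QA) (indBits QB)
  have hZZ := h.reflZ.bitPow_comm (indBits SA) (indBits SB)
  have hF1 := h.reflX.norm_bitPow_apply (indBits QA)
  have hF2 := h.reflX.norm_bitPow_apply (indBits QB)
  have hG1 := h.reflZ.norm_bitPow_apply (indBits SA)
  have hG2 := h.reflZ.norm_bitPow_apply (indBits SB)
  rw [hcard, hchi, hq, ht]
  simp only [h.reflX.bitPow_add_apply, h.reflZ.bitPow_add_apply]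
  generalize bitPow X (indBits QA) = FA at *
  generalize bitPow X (indBits QB) = FB at *
  generalize bitPow Z (indBits SA) = GA at *
  generalize bitPow Z (indBits SB) = GB at *
  set c := chi (indBits QA) (indBits SA)
  set d := chi (indBits QB) (indBits SB) with hd
  have e : FA (FB (GA (GB ψ))) - (c * d) • GA (GB (FA (FB ψ)))
      = FA (GA (FB (GB ψ) - d • GB (FB ψ))) + d • GB (FB (FA (GA ψ) - c • GA (FA ψ))) := by
    have e1 : FA (GA (GB (FB ψ))) = GB (FB (FA (GA ψ))) := by
      rw [commute_apply hZZ, commute_apply hAB, ← commute_apply hBA, commute_apply hXX]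
    have e2 : GB (FB (GA (FA ψ))) = GA (GB (FA (FB ψ))) := by
      rw [commute_apply hBA, ← commute_apply hZZ, commute_apply hXX]
    rw [commute_apply hBA]
    simp only [map_sub, map_smul, smul_sub, smul_smul, e1, e2, mul_comm c d]
    abel
  rw [e]
  refine (norm_add_le _ _).trans ?_
  rw [norm_smul, hd, norm_chi, one_mul, hF1, hG1, hG2, hF2]
  linarith

end ApproxPauli

/-! ### The ideal state and its correlations -/

section Ideal

variable {m : ℕ}

theorem onSite_apply (U : Matrix (Fin 2) (Fin 2) ℂ) (k : Site m) (φ : Qubits m)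
    (s : BitString m) :
    onSite U k φ s = ∑ t, (if ∀ l, l ≠ k → s l = t l then U (s k) (t k) else 0) * φ t := by
  simp [onSite, Matrix.mulVec, dotProduct]

theorem onSite_pauliX_apply (k : Site m) (φ : Qubits m) (s : BitString m) :
    onSite pauliX k φ s = φ (s + Pi.single k 1) := by
  rw [onSite_apply, Finset.sum_eq_single (s + Pi.single k 1)]
  · have h1 : ∀ l, l ≠ k → s l = (s + Pi.single k 1 : BitString m) l :=
      fun l hl => by simp [hl]
    have h2 : ∀ a : Fin 2, pauliX a (a + 1) = 1 := by
      intro a; fin_cases a <;> simp [pauliX]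
    rw [if_pos h1, Pi.add_apply, Pi.single_eq_same, h2, one_mul]
  · intro t _ ht
    split_ifs with h
    · have h2 : ∀ a b : Fin 2, b ≠ a + 1 → pauliX a b = 0 := by
        intro a b; fin_cases a <;> fin_cases b <;> simp [pauliX]
      rw [h2, zero_mul]
      intro hk
      apply ht
      funext l
      by_cases hl : l = k
      · subst hl; simpa using hk
      · simpa [hl] using (h l hl).symm
    · rw [zero_mul]
  · simp

theorem onSite_pauliZ_apply (k : Site m) (φ : Qubits m) (s : BitString m) :
    onSite pauliZ k φ s = chi s (Pi.single k 1) * φ s := by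
  rw [onSite_apply, Finset.sum_eq_single s]
  · have h2 : ∀ a : Fin 2, pauliZ a a = if a = 1 then -1 else 1 := by
      intro a; fin_cases a <;> simp [pauliZ]
    rw [if_pos fun _ _ => rfl, h2, chi_single_right]
  · intro t _ ht
    split_ifs with h
    · have h2 : ∀ a b : Fin 2, b ≠ a → pauliZ a b = 0 := by
        intro a b; fin_cases a <;> fin_cases b <;> simp [pauliZ]
      rw [h2, zero_mul]
      intro hk
      apply ht
      funext l
      by_cases hl : l = k
      · subst hl; exact hk
      · exact (h l hl).symm
    · rw [zero_mul]
  · simp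

theorem onSite_pauliD_apply (k : Site m) (φ : Qubits m) :
    onSite pauliD k φ
      = ((1 / Real.sqrt 2 : ℝ) : ℂ) • (onSite pauliX k φ + onSite pauliZ k φ) := by
  ext s
  rw [PiLp.smul_apply, PiLp.add_apply, onSite_apply, onSite_apply, onSite_apply,
    ← Finset.sum_add_distrib, smul_eq_mul, Finset.mul_sum]
  refine Finset.sum_congr rfl fun t _ => ?_
  split_ifs
  · simp only [pauliD, Matrix.smul_apply, Matrix.add_apply, smul_eq_mul]; ring
  · simp

theorem onSite_symm {U : Matrix (Fin 2) (Fin 2) ℂ} (hU : U.IsHermitian) (k : Site m)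
    (x y : Qubits m) : inner ℂ (onSite U k x) y = inner ℂ x (onSite U k y) := by
  have hs : IsSelfAdjoint (onSite U k) := by
    refine IsSelfAdjoint.map (x := (Matrix.of fun s t : BitString m =>
      if ∀ l, l ≠ k → s l = t l then U (s k) (t k) else 0)) ?_ Matrix.toEuclideanCLM
    ext s t
    rw [Matrix.star_apply, Matrix.of_apply, Matrix.of_apply]
    have hc : (∀ l, l ≠ k → t l = s l) ↔ ∀ l, l ≠ k → s l = t l := by
      simp only [eq_comm]
    simp only [hc]
    split_ifs
    · exact hU.apply _ _
    · simp
  exact (ContinuousLinearMap.isSelfAdjoint_iff_isSymmetric.1 hs) x y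

theorem isHermitian_pauliX : pauliX.IsHermitian := by
  ext i j; fin_cases i <;> fin_cases j <;> simp [pauliX]

theorem isHermitian_pauliZ : pauliZ.IsHermitian := by
  ext i j; fin_cases i <;> fin_cases j <;> simp [pauliZ]

theorem isHermitian_pauliD : pauliD.IsHermitian := by
  unfold pauliD
  rw [Matrix.IsHermitian, Matrix.conjTranspose_smul,
    (isHermitian_pauliX.add isHermitian_pauliZ).eq]
  simp

theorem isHermitian_honestMatrix (q : Question m) (k : Fin m) :
    (honestMatrix q k).IsHermitian := by
  cases q <;> simp only [honestMatrix] <;> (try split_ifs) <;>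
    first
    | exact isHermitian_pauliX
    | exact isHermitian_pauliZ
    | exact isHermitian_pauliD

theorem idealObs_eq (q : Question m) (k : Site m) :
    idealObs q k = onSite (honestMatrix q (k.elim id id)) k := by
  rcases k with k | k <;> rfl

/-- The representation of the group of bit strings by translations of amplitudes. -/
def shiftHom (m : ℕ) : Multiplicative (BitString m) →* (Qubits m →L[ℂ] Qubits m) where
  toFun u := LinearMap.toContinuousLinearMap
    { toFun := fun φ => WithLp.toLp 2 fun s => φ (s + u.toAdd)
      map_add' := fun _ _ => rfl
      map_smul' := fun _ _ => rfl }
  map_one' := by ext φ s; simp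
  map_mul' a b := by
    ext φ s
    change φ (s + (a.toAdd + b.toAdd)) = φ (s + a.toAdd + b.toAdd)
    rw [add_assoc]

/-- The representation of the group of bit strings by multiplication with characters. -/
def charHom (m : ℕ) : Multiplicative (BitString m) →* (Qubits m →L[ℂ] Qubits m) where
  toFun u := LinearMap.toContinuousLinearMap
    { toFun := fun φ => WithLp.toLp 2 fun s => chi s u.toAdd * φ s
      map_add' := fun _ _ => by ext s; simp [mul_add]
      map_smul' := fun _ _ => by ext s; simp [mul_left_comm] }
  map_one' := by ext φ s; simp
  map_mul' a b := by
    ext φ s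
    simp [chi_add_right, mul_assoc]

theorem bitPow_idealObs_X_apply (q : BitString m) (φ : Qubits m) (s : BitString m) :
    bitPow (idealObs Question.X) q φ s = φ (s + q) := by
  rw [bitPow_eq_hom (shiftHom m) (fun k => ?_)]
  · rfl
  · ext φ s
    rw [idealObs_eq]
    exact (onSite_pauliX_apply k φ s).symm

theorem bitPow_idealObs_Z_apply (p : BitString m) (φ : Qubits m) (s : BitString m) :
    bitPow (idealObs Question.Z) p φ s = chi s p * φ s := by
  rw [bitPow_eq_hom (charHom m) (fun k => ?_)]
  · rfl
  · ext φ s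
    rw [idealObs_eq]
    exact (onSite_pauliZ_apply k φ s).symm

/-- The sign of the amplitude of the ideal state at a bit string. -/
def idealSign (s : BitString m) : ℂ :=
  ∏ k : Fin m, if s (Sum.inl k) = 1 ∧ s (Sum.inr k) = 1 then -1 else 1

theorem idealState_apply (s : BitString m) : idealState m s = (1 / 2 : ℂ) ^ m * idealSign s := by
  have : (1 / 2 : ℂ) ^ m = ∏ _k : Fin m, (1 / 2 : ℂ) := by simp
  rw [this, idealSign, ← Finset.prod_mul_distrib]
  change ∏ k : Fin m, (if s (Sum.inl k) = 1 ∧ s (Sum.inr k) = 1 then (-1 / 2 : ℂ) else 1 / 2) = _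
  refine Finset.prod_congr rfl fun k _ => ?_
  split_ifs <;> norm_num

theorem idealSign_eq_or (s : BitString m) : idealSign s = 1 ∨ idealSign s = -1 := by
  unfold idealSign
  refine Finset.prod_induction
    (fun k : Fin m => if s (Sum.inl k) = 1 ∧ s (Sum.inr k) = 1 then (-1 : ℂ) else 1)
    (fun z : ℂ => z = 1 ∨ z = -1) ?_ (Or.inl rfl) fun k _ => ?_
  · rintro a b (rfl | rfl) (rfl | rfl) <;> simp
  · split_ifs <;> simp

@[simp] theorem norm_idealSign (s : BitString m) : ‖idealSign s‖ = 1 := by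
  rcases idealSign_eq_or s with h | h <;> simp [h]

@[simp] theorem conj_idealSign (s : BitString m) :
    (starRingEnd ℂ) (idealSign s) = idealSign s := by
  rcases idealSign_eq_or s with h | h <;> simp [h]

@[simp] theorem conj_idealState_apply (s : BitString m) :
    (starRingEnd ℂ) (idealState m s) = idealState m s := by
  rw [idealState_apply, map_mul, conj_idealSign, map_pow, map_div₀, map_one, map_ofNat]

theorem idealSign_add_single (s : BitString m) (k : Site m) :
    idealSign (s + Pi.single k 1) = chi s (Pi.single k.swap 1) * idealSign s := by
  have hab : ∀ a b : Fin 2, (if a + 1 = 1 ∧ b = 1 then (-1 : ℂ) else 1)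
      = (if b = 1 then -1 else 1) * if a = 1 ∧ b = 1 then -1 else 1 := by
    intro a b
    fin_cases a <;> fin_cases b <;> simp
  rw [chi_single_right]
  unfold idealSign
  rcases k with i | i
  · rw [← Finset.mul_prod_erase _ _ (Finset.mem_univ i),
      ← Finset.mul_prod_erase _ (fun k : Fin m => if s (Sum.inl k) = 1 ∧ _ then _ else _)
        (Finset.mem_univ i), ← mul_assoc]
    congr 1
    · have h1 : (s + Pi.single (Sum.inl i) 1 : BitString m) (Sum.inl i) = s (Sum.inl i) + 1 := by
        simp
      have h2 : (s + Pi.single (Sum.inl i) 1 : BitString m) (Sum.inr i) = s (Sum.inr i) := by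
        simp
      rw [h1, h2]
      exact hab (s (Sum.inl i)) (s (Sum.inr i))
    · refine Finset.prod_congr rfl fun j hj => ?_
      simp [Finset.ne_of_mem_erase hj]
  · rw [← Finset.mul_prod_erase _ _ (Finset.mem_univ i),
      ← Finset.mul_prod_erase _ (fun k : Fin m => if s (Sum.inl k) = 1 ∧ _ then _ else _)
        (Finset.mem_univ i), ← mul_assoc]
    congr 1
    · have h1 : (s + Pi.single (Sum.inr i) 1 : BitString m) (Sum.inr i) = s (Sum.inr i) + 1 := by
        simp
      have h2 : (s + Pi.single (Sum.inr i) 1 : BitString m) (Sum.inl i) = s (Sum.inl i) := by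
        simp
      rw [h1, h2]
      simp only [and_comm (b := s (Sum.inr i) = 1), and_comm (b := s (Sum.inr i) + 1 = 1)]
      exact hab (s (Sum.inr i)) (s (Sum.inl i))
    · refine Finset.prod_congr rfl fun j hj => ?_
      simp [Finset.ne_of_mem_erase hj]

theorem card_bitString : Fintype.card (BitString m) = 4 ^ m := by
  simp [← two_mul, pow_mul]

theorem norm_idealState_apply_sq (s : BitString m) :
    ‖idealState m s‖ ^ 2 = 1 / Fintype.card (BitString m) := by
  rw [idealState_apply, card_bitString, norm_mul, norm_idealSign, mul_one, norm_pow, ← pow_mul,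
    mul_comm, pow_mul]
  push_cast
  rw [← one_div_pow]
  norm_num

theorem norm_idealState : ‖idealState m‖ = 1 := by
  have h : ‖idealState m‖ ^ 2 = 1 := by
    rw [EuclideanSpace.norm_sq_eq]
    simp only [norm_idealState_apply_sq, Finset.sum_const, Finset.card_univ, nsmul_eq_mul]
    exact mul_one_div_cancel card_bitString_pos.ne'
  nlinarith [norm_nonneg (idealState m)]

/-- The stabilizer relations of the ideal state. -/
theorem onSite_pauliX_idealState (k : Site m) :
    onSite pauliX k (idealState m) = onSite pauliZ k.swap (idealState m) := by
  ext s
  rw [onSite_pauliX_apply, onSite_pauliZ_apply, idealState_apply, idealState_apply,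
    idealSign_add_single]
  ring

theorem inner_pauliZ_pauliZ (k l : Site m) :
    inner ℂ (onSite pauliZ k (idealState m)) (onSite pauliZ l (idealState m))
      = if k = l then 1 else 0 := by
  have h : inner ℂ (onSite pauliZ k (idealState m)) (onSite pauliZ l (idealState m))
      = 1 / (Fintype.card (BitString m) : ℂ)
        * ∑ s : BitString m, chi s (Pi.single k 1 + Pi.single l 1) := by
    rw [PiLp.inner_apply, Finset.mul_sum]
    refine Finset.sum_congr rfl fun s _ => ?_
    rw [onSite_pauliZ_apply, onSite_pauliZ_apply, chi_add_right, RCLike.inner_apply, map_mul,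
      conj_chi]
    have hn : idealState m s * (starRingEnd ℂ) (idealState m s)
        = 1 / (Fintype.card (BitString m) : ℂ) := by
      rw [Complex.mul_conj, Complex.normSq_eq_norm_sq, norm_idealState_apply_sq]
      push_cast
      rfl
    rw [← hn]
    ring
  rw [h, sum_chi]
  have hN : (Fintype.card (BitString m) : ℂ) ≠ 0 := by
    exact_mod_cast Fintype.card_ne_zero
  by_cases hkl : k = l
  · subst hkl
    rw [if_pos rfl, if_pos (bitString_add_self _), one_div_mul_cancel hN]
  · rw [if_neg hkl, if_neg, mul_zero]
    intro h0
    have := congrFun h0 k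
    simp [hkl] at this

theorem inner_pauliX_pauliZ (k : Site m) :
    inner ℂ (onSite pauliX k (idealState m)) (onSite pauliZ k.swap (idealState m)) = 1 := by
  rw [onSite_pauliX_idealState, inner_pauliZ_pauliZ, if_pos rfl]

theorem inner_pauliZ_pauliX (k : Site m) :
    inner ℂ (onSite pauliZ k (idealState m)) (onSite pauliX k.swap (idealState m)) = 1 := by
  rw [onSite_pauliX_idealState, Sum.swap_swap, inner_pauliZ_pauliZ, if_pos rfl]

theorem swap_ne (k : Site m) : k.swap ≠ k := by
  rcases k with k | k <;> simp

theorem inner_pauliX_pauliX (k : Site m) :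
    inner ℂ (onSite pauliX k (idealState m)) (onSite pauliX k.swap (idealState m)) = 0 := by
  rw [onSite_pauliX_idealState, onSite_pauliX_idealState, inner_pauliZ_pauliZ,
    if_neg (by simpa using swap_ne k)]

theorem inner_pauliX_pauliD (k : Site m) :
    inner ℂ (onSite pauliX k (idealState m)) (onSite pauliD k.swap (idealState m))
      = ((1 / Real.sqrt 2 : ℝ) : ℂ) := by
  rw [onSite_pauliD_apply, inner_smul_right, inner_add_right, inner_pauliX_pauliX,
    inner_pauliX_pauliZ, zero_add, mul_one]

theorem inner_pauliZ_pauliD (k : Site m) :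
    inner ℂ (onSite pauliZ k (idealState m)) (onSite pauliD k.swap (idealState m))
      = ((1 / Real.sqrt 2 : ℝ) : ℂ) := by
  rw [onSite_pauliD_apply, inner_smul_right, inner_add_right, inner_pauliZ_pauliX,
    inner_pauliZ_pauliZ, if_neg (swap_ne k).symm, add_zero, mul_one]

end Ideal

/-! ### The swap isometry -/

section Tensor

variable {V : Type*} [NormedAddCommGroup V] [InnerProductSpace ℂ V] {m : ℕ}

/-- The vector of `V ⊗ (ℂ²)^{⊗ 2 m}` with components `v s` along the computational basis. -/
def tensorVec (v : BitString m → V) : V ⊗[ℂ] Qubits m :=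
  ∑ s, v s ⊗ₜ[ℂ] EuclideanSpace.single s (1 : ℂ)

theorem tensorVec_add (v w : BitString m → V) :
    tensorVec (v + w) = tensorVec v + tensorVec w := by
  simp [tensorVec, TensorProduct.add_tmul, Finset.sum_add_distrib]

theorem tensorVec_smul (c : ℂ) (v : BitString m → V) : tensorVec (c • v) = c • tensorVec v := by
  simp [tensorVec, TensorProduct.smul_tmul', Finset.smul_sum]

theorem tensorVec_sub (v w : BitString m → V) :
    tensorVec (v - w) = tensorVec v - tensorVec w := by
  simp [tensorVec, TensorProduct.sub_tmul]

theorem norm_tensorVec_sq (v : BitString m → V) : ‖tensorVec v‖ ^ 2 = ∑ s, ‖v s‖ ^ 2 := by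
  rw [norm_sq_eq_re_inner (𝕜 := ℂ), tensorVec, sum_inner, map_sum]
  refine Finset.sum_congr rfl fun s _ => ?_
  rw [inner_sum, Finset.sum_eq_single s]
  · rw [TensorProduct.inner_tmul, norm_sq_eq_re_inner (𝕜 := ℂ)]
    simp
  · intro t _ hts
    rw [TensorProduct.inner_tmul, EuclideanSpace.inner_single_left]
    simp [hts.symm]
  · simp

theorem tmul_eq_tensorVec (x : V) (w : Qubits m) : x ⊗ₜ[ℂ] w = tensorVec fun s => w s • x := by
  have hw : w = ∑ s, w s • EuclideanSpace.single s (1 : ℂ) := by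
    ext t
    simp [Finset.sum_apply, Pi.single_apply]
  conv_lhs => rw [hw]
  rw [TensorProduct.tmul_sum, tensorVec]
  refine Finset.sum_congr rfl fun s _ => ?_
  rw [TensorProduct.tmul_smul, TensorProduct.smul_tmul']

end Tensor

section Swap

variable {V : Type*} [NormedAddCommGroup V] [InnerProductSpace ℂ V] {m : ℕ}
  {X Z : Site m → V →L[ℂ] V}

/-- The joint spectral projection of the operators `Z k` onto the eigenvalues `(-1) ^ s k`,
written as a Fourier transform of the products `Z ^ t`. -/
def specProj (Z : Site m → V →L[ℂ] V) (s : BitString m) : V →L[ℂ] V :=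
  (Fintype.card (BitString m) : ℂ)⁻¹ • ∑ t, chi s t • bitPow Z t

theorem specProj_apply (Z : Site m → V →L[ℂ] V) (s : BitString m) (v : V) :
    specProj Z s v = (Fintype.card (BitString m) : ℂ)⁻¹ • ∑ t, chi s t • bitPow Z t v := by
  simp [specProj]

theorem specProj_bitPow_apply (hZ : IsReflectionFamily Z) (s p : BitString m) (v : V) :
    specProj Z s (bitPow Z p v) = chi s p • specProj Z s v := by
  have e : ∑ t, chi s t • bitPow Z t (bitPow Z p v)
      = chi s p • ∑ t, chi s t • bitPow Z t v := by
    rw [← sum_add_right (fun t => chi s t • bitPow Z t (bitPow Z p v)) p, Finset.smul_sum]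
    refine Finset.sum_congr rfl fun t _ => ?_
    rw [← hZ.bitPow_add_apply, bitString_add_cancel, chi_add_right, mul_comm, smul_smul]
  rw [specProj_apply, specProj_apply, e, smul_comm]

theorem sum_norm_specProj_sub_sq (X Z : Site m → V →L[ℂ] V) (q : BitString m) (a b : V) :
    ∑ s, ‖specProj Z s a - bitPow X q (specProj Z (s + q) b)‖ ^ 2
      = (Fintype.card (BitString m) : ℝ)⁻¹
        * ∑ t, ‖bitPow Z t a - chi q t • bitPow X q (bitPow Z t b)‖ ^ 2 := by
  have h1 : ∀ s, specProj Z s a - bitPow X q (specProj Z (s + q) b)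
      = (Fintype.card (BitString m) : ℂ)⁻¹ •
        ∑ t, chi s t • (bitPow Z t a - chi q t • bitPow X q (bitPow Z t b)) := by
    intro s
    rw [specProj_apply, specProj_apply, map_smul, ← smul_sub, map_sum, ← Finset.sum_sub_distrib]
    congr 1
    refine Finset.sum_congr rfl fun t _ => ?_
    rw [map_smul, chi_add_left, smul_sub, smul_smul]
  simp only [h1, norm_smul, mul_pow, norm_inv, Complex.norm_natCast]
  rw [← Finset.mul_sum, sum_norm_sq_sum_chi_smul]
  have := (card_bitString_pos (m := m)).ne'
  field_simp

theorem sum_norm_specProj_sq (hZ : IsReflectionFamily Z) (v : V) :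
    ∑ s, ‖specProj Z s v‖ ^ 2 = ‖v‖ ^ 2 := by
  simp only [specProj_apply, norm_smul, mul_pow, norm_inv, Complex.norm_natCast]
  rw [← Finset.mul_sum, sum_norm_sq_sum_chi_smul]
  simp only [hZ.norm_bitPow_apply, Finset.sum_const, Finset.card_univ, nsmul_eq_mul]
  have := (card_bitString_pos (m := m)).ne'
  field_simp

/-- The component along the computational basis vector `s` of the swap isometry. -/
def swapComp (X Z : Site m → V →L[ℂ] V) (s : BitString m) (v : V) : V :=
  bitPow X s (specProj Z s v)

/-- The swap isometry `v ↦ ∑ₛ X ^ s Πₛ v ⊗ |s⟩`, where `Πₛ` are the joint spectral projections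
of the operators `Z k`. -/
def swapIsometry (hX : IsReflectionFamily X) (hZ : IsReflectionFamily Z) :
    V →ₗᵢ[ℂ] V ⊗[ℂ] Qubits m where
  toFun v := tensorVec fun s => swapComp X Z s v
  map_add' v w := by
    rw [← tensorVec_add]
    congr 1
    funext s
    simp [swapComp]
  map_smul' c v := by
    rw [RingHom.id_apply, ← tensorVec_smul]
    congr 1
    funext s
    simp [swapComp]
  norm_map' v := by
    refine (sq_eq_sq₀ (norm_nonneg _) (norm_nonneg _)).1 ?_
    change ‖tensorVec fun s => swapComp X Z s v‖ ^ 2 = _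
    rw [norm_tensorVec_sq]
    simp only [swapComp, hX.norm_bitPow_apply]
    exact sum_norm_specProj_sq hZ v

theorem swapIsometry_apply (hX : IsReflectionFamily X) (hZ : IsReflectionFamily Z) (v : V) :
    swapIsometry hX hZ v = tensorVec fun s => swapComp X Z s v := rfl

end Swap

/-! ### Robustness of the swap isometry -/

section Unit

variable {V : Type*} [NormedAddCommGroup V] [InnerProductSpace ℂ V]

theorem exists_unit_inner_eq_norm {ψ : V} (hψ : ‖ψ‖ = 1) (J : V) :
    ∃ u : V, ‖u‖ = 1 ∧ inner ℂ J u = (‖J‖ : ℂ) := by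
  by_cases hJ : J = 0
  · exact ⟨ψ, hψ, by simp [hJ]⟩
  · have hJ' : ‖J‖ ≠ 0 := norm_ne_zero_iff.2 hJ
    refine ⟨(‖J‖ : ℂ)⁻¹ • J, ?_, ?_⟩
    · rw [norm_smul, norm_inv, Complex.norm_real, norm_norm, inv_mul_cancel₀ hJ']
    · rw [inner_smul_right, inner_self_eq_norm_sq_to_K]
      have : (‖J‖ : ℂ) ≠ 0 := by exact_mod_cast hJ'
      simp only [Complex.coe_algebraMap]
      field_simp

end Unit

namespace ApproxPauli

variable {V : Type*} [NormedAddCommGroup V] [InnerProductSpace ℂ V] {m : ℕ}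
  {X Z : Site m → V →L[ℂ] V} {ψ : V} {δ η : ℝ} (h : ApproxPauli X Z ψ δ η)

include h

/-- The relations are symmetric in `X` and `Z`. -/
theorem symm : ApproxPauli Z X ψ δ η where
  reflX := h.reflZ
  reflZ := h.reflX
  comm_of_ne k l hkl := (h.comm_of_ne l k hkl.symm).symm
  delta_nonneg := h.delta_nonneg
  eta_nonneg := h.eta_nonneg
  stab k := by
    have := h.stab k.swap
    rwa [Sum.swap_swap, norm_sub_rev] at this
  anti k := by rw [add_comm]; exact h.anti k
  almost_comm k l hkl := by rw [norm_sub_rev]; exact h.almost_comm l k hkl.symm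

theorem err_nonneg (hm : m ≠ 0) : 0 ≤ η + 4 * δ + 6 * δ * ((m : ℝ) - 1) := by
  have h1 : (1 : ℝ) ≤ m := by exact_mod_cast Nat.one_le_iff_ne_zero.2 hm
  have := mul_nonneg h.delta_nonneg (sub_nonneg.2 h1)
  linarith [h.delta_nonneg, h.eta_nonneg]

/-- The swap isometry intertwines `X ^ q` with the translation by `q`, approximately on the
vectors `Z ^ p ψ`. The constant `0.71` bounds `1 / √2`, the root mean square of a random bit. -/
theorem sum_swapComp_sub_sq_le (p q : BitString m) :
    ∑ s, ‖swapComp X Z s (bitPow X q (bitPow Z p ψ))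
          - chi p (s + q) • swapComp X Z (s + q) ψ‖ ^ 2
      ≤ ((η + 4 * δ + 6 * δ * (m - 1)) * (hammingNorm p + 0.71 * (2 * m))) ^ 2 := by
  set x := η + 4 * δ + 6 * δ * ((m : ℝ) - 1)
  set N : ℝ := (Fintype.card (BitString m) : ℝ) with hN
  have hNpos : 0 < N := card_bitString_pos
  have e : ∀ s, ‖swapComp X Z s (bitPow X q (bitPow Z p ψ))
        - chi p (s + q) • swapComp X Z (s + q) ψ‖
      = ‖specProj Z s (bitPow X q (bitPow Z p ψ))
        - bitPow X q (specProj Z (s + q) (bitPow Z p ψ))‖ := by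
    intro s
    rw [specProj_bitPow_apply h.reflZ, chi_comm p, swapComp, swapComp,
      h.reflX.bitPow_add_apply, ← map_smul, ← map_smul, ← map_sub, h.reflX.norm_bitPow_apply]
  have hd : ∀ t, ‖bitPow Z t (bitPow X q (bitPow Z p ψ))
        - chi q t • bitPow X q (bitPow Z t (bitPow Z p ψ))‖
      ≤ x * (hammingNorm p + hammingNorm (t + p)) := by
    intro t
    have hc : chi q t * chi q (t + p) = chi q p := by
      rw [chi_add_right, ← mul_assoc, chi_mul_self, one_mul]
    have e2 : bitPow Z t (bitPow X q (bitPow Z p ψ))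
          - chi q t • bitPow X q (bitPow Z t (bitPow Z p ψ))
        = bitPow Z t (bitPow X q (bitPow Z p ψ) - chi q p • bitPow Z p (bitPow X q ψ))
          - chi q t • (bitPow X q (bitPow Z (t + p) ψ)
            - chi q (t + p) • bitPow Z (t + p) (bitPow X q ψ)) := by
      rw [smul_sub, smul_smul, hc, map_sub, map_smul, ← h.reflZ.bitPow_add_apply,
        ← h.reflZ.bitPow_add_apply]
      abel
    rw [e2]
    refine (norm_sub_le _ _).trans ?_
    rw [h.reflZ.norm_bitPow_apply, norm_smul, norm_chi, one_mul]
    have h1 := h.norm_bitPow_comm_le q p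
    have h2 := h.norm_bitPow_comm_le q (t + p)
    linarith
  simp only [e]
  rw [sum_norm_specProj_sub_sq, ← hN]
  set w : ℝ := (hammingNorm p : ℝ)
  have hw : 0 ≤ w := Nat.cast_nonneg _
  -- the square of the weight is at most `2 * m` times the weight, which is `m` on average
  have hsq : ∀ t : BitString m, (x * (w + hammingNorm t)) ^ 2
      ≤ x ^ 2 * (w ^ 2 + (2 * w + 2 * m) * hammingNorm t) := by
    intro t
    have h1 : (hammingNorm t : ℝ) ≤ 2 * m := by exact_mod_cast hammingNorm_le t
    have h0 : (0 : ℝ) ≤ hammingNorm t := Nat.cast_nonneg _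
    rw [mul_pow]
    refine mul_le_mul_of_nonneg_left ?_ (sq_nonneg x)
    nlinarith
  have hsum : ∑ t, ‖bitPow Z t (bitPow X q (bitPow Z p ψ))
        - chi q t • bitPow X q (bitPow Z t (bitPow Z p ψ))‖ ^ 2
      ≤ N * (x ^ 2 * (w ^ 2 + (2 * w + 2 * m) * m)) := by
    calc _ ≤ ∑ t : BitString m, (x * (w + hammingNorm (t + p))) ^ 2 :=
          Finset.sum_le_sum fun t _ => pow_le_pow_left₀ (norm_nonneg _) (hd t) 2
      _ = ∑ t : BitString m, (x * (w + hammingNorm t)) ^ 2 :=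
          sum_add_right (fun t : BitString m => (x * (w + (hammingNorm t : ℝ))) ^ 2) p
      _ ≤ ∑ t : BitString m, x ^ 2 * (w ^ 2 + (2 * w + 2 * m) * hammingNorm t) :=
          Finset.sum_le_sum fun t _ => hsq t
      _ = _ := by
          rw [← Finset.mul_sum, Finset.sum_add_distrib, ← Finset.mul_sum, sum_hammingNorm,
            Finset.sum_const, Finset.card_univ, nsmul_eq_mul]
          ring
  calc _ ≤ N⁻¹ * (N * (x ^ 2 * (w ^ 2 + (2 * w + 2 * m) * m))) :=
        mul_le_mul_of_nonneg_left hsum (inv_nonneg.2 hNpos.le)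
    _ = x ^ 2 * (w ^ 2 + (2 * w + 2 * m) * m) := by rw [inv_mul_cancel_left₀ hNpos.ne']
    _ ≤ _ := by
        rw [mul_pow]
        refine mul_le_mul_of_nonneg_left ?_ (sq_nonneg x)
        nlinarith [mul_nonneg hw (Nat.cast_nonneg (α := ℝ) m), sq_nonneg (m : ℝ)]

/-- The swap isometry maps `ψ` to a vector that is approximately a product with the ideal state.
The mean `J` of the components, with the signs of the ideal state removed, has norm close to `1`
by Poincaré's inequality, since the discrete derivatives measure stabilizer relations. -/
theorem exists_junk (hψ : ‖ψ‖ = 1) :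
    ∃ junk : V, ‖junk‖ = 1 ∧
      ∑ s, ‖swapComp X Z s ψ - idealState m s • junk‖ ^ 2
        ≤ m * (η + 5 * δ + 6 * δ * (m - 1)) ^ 2 := by
  set y := η + 5 * δ + 6 * δ * ((m : ℝ) - 1)
  set N : ℝ := (Fintype.card (BitString m) : ℝ) with hN
  have hNpos : 0 < N := card_bitString_pos
  set g : BitString m → V := fun s => idealSign s • swapComp X Z s ψ with hg
  set J : V := ∑ s, idealState m s • swapComp X Z s ψ with hJ
  have hF : ∑ s, ‖swapComp X Z s ψ‖ ^ 2 = 1 := by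
    simp only [swapComp, h.reflX.norm_bitPow_apply]
    rw [sum_norm_specProj_sq h.reflZ, hψ, one_pow]
  have hgn : ∑ s, ‖g s‖ ^ 2 = 1 := by
    simp only [hg, norm_smul, norm_idealSign, one_mul]
    exact hF
  have hgJ : ‖∑ s, g s‖ ^ 2 / N = ‖J‖ ^ 2 := by
    have : J = (1 / 2 : ℂ) ^ m • ∑ s, g s := by
      rw [hJ, hg, Finset.smul_sum]
      refine Finset.sum_congr rfl fun s _ => ?_
      rw [idealState_apply, smul_smul]
    rw [this, norm_smul, mul_pow, norm_pow, hN, card_bitString, ← pow_mul, mul_comm m 2, pow_mul]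
    push_cast
    norm_num
    rw [div_eq_inv_mul, ← inv_pow]
    norm_num
  have hder : ∀ k : Site m, ∑ s, ‖g s - g (s + Pi.single k 1)‖ ^ 2 ≤ y ^ 2 := by
    intro k
    have e : ∀ s, ‖g s - g (s + Pi.single k 1)‖
        = ‖specProj Z s (Z k.swap ψ)
          - bitPow X (Pi.single k 1) (specProj Z (s + Pi.single k 1) ψ)‖ := by
      intro s
      have e1 : g s - g (s + Pi.single k 1)
          = (chi s (Pi.single k.swap 1) * idealSign s) • bitPow X s (specProj Z s (Z k.swap ψ)
            - bitPow X (Pi.single k 1) (specProj Z (s + Pi.single k 1) ψ)) := by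
        rw [← bitPow_single Z k.swap, specProj_bitPow_apply h.reflZ, hg]
        simp only [swapComp, idealSign_add_single]
        rw [h.reflX.bitPow_add_apply, map_sub, map_smul, smul_sub, smul_smul, mul_right_comm,
          chi_mul_self, one_mul]
      rw [e1, norm_smul, norm_mul, norm_chi, norm_idealSign, one_mul, one_mul,
        h.reflX.norm_bitPow_apply]
    simp only [e]
    rw [sum_norm_specProj_sub_sq, ← hN]
    have hd : ∀ t, ‖bitPow Z t (Z k.swap ψ)
        - chi (Pi.single k 1) t • bitPow X (Pi.single k 1) (bitPow Z t ψ)‖ ≤ y := by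
      intro t
      have e2 : bitPow Z t (Z k.swap ψ)
            - chi (Pi.single k 1) t • bitPow X (Pi.single k 1) (bitPow Z t ψ)
          = bitPow Z t (Z k.swap ψ - X k ψ)
            + (bitPow Z t (bitPow X (Pi.single k 1) ψ)
              - chi t (Pi.single k 1) • bitPow X (Pi.single k 1) (bitPow Z t ψ)) := by
        rw [chi_comm, map_sub, bitPow_single]
        abel
      rw [e2]
      refine (norm_add_le _ _).trans ?_
      rw [h.reflZ.norm_bitPow_apply, norm_sub_rev]
      have h1 := h.stab k
      have h2 := h.symm.norm_bitPow_comm_le t (Pi.single k 1)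
      have h3 : hammingNorm (Pi.single k 1 : BitString m) = 1 := by
        unfold hammingNorm
        rw [Finset.card_eq_one]
        refine ⟨k, ?_⟩
        ext l
        by_cases hl : l = k
        · subst hl; simp
        · simp [hl]
      rw [h3, Nat.cast_one, one_mul] at h2
      linarith
    calc _ ≤ N⁻¹ * ∑ _t : BitString m, y ^ 2 :=
          mul_le_mul_of_nonneg_left
            (Finset.sum_le_sum fun t _ => pow_le_pow_left₀ (norm_nonneg _) (hd t) 2)
            (inv_nonneg.2 hNpos.le)
      _ = y ^ 2 := by
          rw [Finset.sum_const, Finset.card_univ, nsmul_eq_mul, ← hN,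
            inv_mul_cancel_left₀ hNpos.ne']
  have hP : 1 - ‖J‖ ^ 2 ≤ 1 / 2 * (m * y ^ 2) := by
    have h1 := sum_norm_sq_sub_le g
    rw [hgn, ← hN, hgJ] at h1
    have h2 : ∑ k : Site m, ∑ s, ‖g s - g (s + Pi.single k 1)‖ ^ 2 ≤ (2 * m) * y ^ 2 := by
      refine (Finset.sum_le_sum fun k _ => hder k).trans_eq ?_
      rw [Finset.sum_const, Finset.card_univ, nsmul_eq_mul]
      simp [two_mul]
    linarith
  obtain ⟨junk, hj1, hjJ⟩ := exists_unit_inner_eq_norm hψ J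
  refine ⟨junk, hj1, ?_⟩
  have hsum : ∑ s, ‖swapComp X Z s ψ - idealState m s • junk‖ ^ 2 = 2 - 2 * ‖J‖ := by
    have h1 : ∑ s, RCLike.re (inner ℂ (swapComp X Z s ψ) (idealState m s • junk)) = ‖J‖ := by
      have h2 : inner ℂ J junk
          = ∑ s, inner ℂ (swapComp X Z s ψ) (idealState m s • junk) := by
        rw [hJ, sum_inner]
        refine Finset.sum_congr rfl fun s _ => ?_
        rw [inner_smul_left, inner_smul_right, conj_idealState_apply]
      rw [← map_sum, ← h2, hjJ]
      simp
    have h3 : ∑ s, ‖idealState m s • junk‖ ^ 2 = 1 := by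
      simp only [norm_smul, hj1, mul_one]
      rw [← EuclideanSpace.norm_sq_eq, norm_idealState, one_pow]
    simp only [norm_sub_sq (𝕜 := ℂ)]
    rw [Finset.sum_add_distrib, Finset.sum_sub_distrib, ← Finset.mul_sum, h1, h3, hF]
    ring
  rw [hsum]
  have hmy : (0 : ℝ) ≤ m * y ^ 2 := by positivity
  by_cases hJ1 : ‖J‖ ≤ 1
  · nlinarith [norm_nonneg J]
  · linarith

/-- Self-testing from approximate Pauli relations. -/
theorem exists_isometry (hψ : ‖ψ‖ = 1) :
    ∃ (Φ : V →ₗᵢ[ℂ] V ⊗[ℂ] Qubits m) (junk : V), ‖junk‖ = 1 ∧ ∀ p q : BitString m,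
      ‖Φ (bitPow X q (bitPow Z p ψ)) - junk ⊗ₜ[ℂ] (bitPow (idealObs Question.X) q
          (bitPow (idealObs Question.Z) p (idealState m)))‖
        ≤ (η + 4 * δ + 6 * δ * (m - 1)) * (hammingNorm p + 0.71 * (2 * m))
          + m * (η + 5 * δ + 6 * δ * (m - 1)) := by
  obtain ⟨junk, hj1, hj⟩ := h.exists_junk hψ
  refine ⟨swapIsometry h.reflX h.reflZ, junk, hj1, fun p q => ?_⟩
  have hx0 : 0 ≤ (η + 4 * δ + 6 * δ * (m - 1)) * (hammingNorm p + 0.71 * (2 * m)) := by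
    rcases eq_or_ne m 0 with rfl | hm
    · have : hammingNorm p = 0 := by simp [hammingNorm]
      simp [this]
    · exact mul_nonneg (h.err_nonneg hm) (by positivity)
  have hy0 : 0 ≤ (m : ℝ) * (η + 5 * δ + 6 * δ * (m - 1)) := by
    rcases eq_or_ne m 0 with rfl | hm
    · simp
    · have := h.err_nonneg hm
      exact mul_nonneg (Nat.cast_nonneg _) (by linarith [h.delta_nonneg])
  -- the image of `ψ` under the swap isometry, acted on by the ideal operators
  set U : BitString m → V := fun s => chi p (s + q) • swapComp X Z (s + q) ψ with hU
  have hideal : ∀ s, bitPow (idealObs Question.X) q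
      (bitPow (idealObs Question.Z) p (idealState m)) s
        = chi p (s + q) * idealState m (s + q) := by
    intro s
    rw [bitPow_idealObs_X_apply, bitPow_idealObs_Z_apply, chi_comm]
  rw [swapIsometry_apply, tmul_eq_tensorVec]
  have e : (tensorVec fun s => swapComp X Z s (bitPow X q (bitPow Z p ψ)))
        - tensorVec (fun s => bitPow (idealObs Question.X) q
          (bitPow (idealObs Question.Z) p (idealState m)) s • junk)
      = tensorVec ((fun s => swapComp X Z s (bitPow X q (bitPow Z p ψ))) - U)
        + tensorVec (U - fun s => bitPow (idealObs Question.X) q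
          (bitPow (idealObs Question.Z) p (idealState m)) s • junk) := by
    rw [tensorVec_sub, tensorVec_sub]
    abel
  rw [e]
  refine (norm_add_le _ _).trans (add_le_add ?_ ?_)
  · refine (sq_le_sq₀ (norm_nonneg _) hx0).1 ?_
    rw [norm_tensorVec_sq]
    exact h.sum_swapComp_sub_sq_le p q
  · refine (sq_le_sq₀ (norm_nonneg _) hy0).1 ?_
    rw [norm_tensorVec_sq]
    have e2 : ∀ s, ‖(U - fun s => bitPow (idealObs Question.X) q
          (bitPow (idealObs Question.Z) p (idealState m)) s • junk) s‖ ^ 2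
        = ‖swapComp X Z (s + q) ψ - idealState m (s + q) • junk‖ ^ 2 := by
      intro s
      rw [Pi.sub_apply, hideal, hU, mul_smul, ← smul_sub, norm_smul, norm_chi, one_mul]
    simp only [e2]
    rw [sum_add_right (fun s => ‖swapComp X Z s ψ - idealState m s • junk‖ ^ 2) q]
    refine hj.trans ?_
    rw [mul_pow]
    refine mul_le_mul_of_nonneg_right ?_ (sq_nonneg _)
    -- `√m ≤ m` for natural numbers
    exact_mod_cast Nat.le_self_pow two_ne_zero m

end ApproxPauli

/-! ### The observables of the players -/

section Obs

variable {H : Type*} [NormedAddCommGroup H] [InnerProductSpace ℂ H] [CompleteSpace H] {m : ℕ}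

theorem ProjMeas.obs_eq (P : ProjMeas H (Answer m)) (k : Fin m) :
    P.obs k = ∑ a, ((a k : ℤ) : ℂ) • P.proj a := by
  unfold ProjMeas.obs ProjMeas.symbolProj
  rw [Finset.sum_filter, Finset.sum_filter, ← Finset.sum_sub_distrib]
  refine Finset.sum_congr rfl fun a _ => ?_
  rcases Int.units_eq_one_or (a k) with h | h <;> rw [h]
  · rw [if_pos rfl, if_neg (by decide)]; simp
  · rw [if_neg (by decide), if_pos rfl]; simp

theorem ProjMeas.sum_smul_mul_sum_smul (P : ProjMeas H (Answer m)) (c d : Answer m → ℂ) :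
    (∑ a, c a • P.proj a) * (∑ a, d a • P.proj a) = ∑ a, (c a * d a) • P.proj a := by
  rw [Finset.sum_mul]
  refine Finset.sum_congr rfl fun a _ => ?_
  rw [Finset.mul_sum, Finset.sum_eq_single a]
  · rw [smul_mul_smul_comm, P.mul_proj, if_pos rfl]
  · intro b _ hb
    rw [smul_mul_smul_comm, P.mul_proj, if_neg hb.symm, smul_zero]
  · simp

theorem ProjMeas.obs_mul_self (P : ProjMeas H (Answer m)) (k : Fin m) :
    P.obs k * P.obs k = 1 := by
  rw [P.obs_eq, P.sum_smul_mul_sum_smul, ← P.sum_proj]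
  refine Finset.sum_congr rfl fun a _ => ?_
  rw [← Int.cast_mul, ← Units.val_mul, Int.units_mul_self]
  simp

theorem ProjMeas.obs_comm (P : ProjMeas H (Answer m)) (k l : Fin m) :
    Commute (P.obs k) (P.obs l) := by
  rw [Commute, SemiconjBy, P.obs_eq, P.obs_eq, P.sum_smul_mul_sum_smul, P.sum_smul_mul_sum_smul]
  simp only [mul_comm]

theorem ProjMeas.obs_symm (P : ProjMeas H (Answer m)) (k : Fin m) (x y : H) :
    inner ℂ (P.obs k x) y = inner ℂ x (P.obs k y) := by
  have hs : IsSelfAdjoint (P.obs k) := by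
    unfold ProjMeas.obs ProjMeas.symbolProj
    exact (isSelfAdjoint_sum _ fun a _ => P.isSelfAdjoint a).sub
      (isSelfAdjoint_sum _ fun a _ => P.isSelfAdjoint a)
  exact (ContinuousLinearMap.isSelfAdjoint_iff_isSymmetric.1 hs) x y

end Obs

section Completion

open UniformSpace (Completion)

variable {E F : Type*} [NormedAddCommGroup E] [InnerProductSpace ℂ E]
  [NormedAddCommGroup F] [InnerProductSpace ℂ F]

theorem completion_mul (S T : E →L[ℂ] E) :
    (S * T).completion = S.completion * T.completion := by
  ext x
  induction x using Completion.induction_on with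
  | hp =>
    exact isClosed_eq (S * T).completion.continuous (S.completion * T.completion).continuous
  | ih x =>
    simp only [mul_apply_eq_comp, ContinuousLinearMap.completion_apply_coe]

theorem completion_one : (1 : E →L[ℂ] E).completion = 1 := by
  ext x
  induction x using Completion.induction_on with
  | hp => exact isClosed_eq (1 : E →L[ℂ] E).completion.continuous continuous_id
  | ih x => simp

theorem completion_symm {T : E →L[ℂ] E} (hT : ∀ x y, inner ℂ (T x) y = inner ℂ x (T y))
    (x y : Completion E) : inner ℂ (T.completion x) y = inner ℂ x (T.completion y) := by
  induction x, y using Completion.induction_on₂ with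
  | hp =>
    exact isClosed_eq
      ((T.completion.continuous.comp continuous_fst).inner continuous_snd)
      (continuous_fst.inner (T.completion.continuous.comp continuous_snd))
  | ih x y =>
    rw [ContinuousLinearMap.completion_apply_coe, ContinuousLinearMap.completion_apply_coe,
      Completion.inner_coe, Completion.inner_coe, hT]

theorem rTensor_symm {T : E →L[ℂ] E} (hT : ∀ x y, inner ℂ (T x) y = inner ℂ x (T y))
    (x y : E ⊗[ℂ] F) : inner ℂ (T.rTensor F x) y = inner ℂ x (T.rTensor F y) := by
  induction x using TensorProduct.induction_on with
  | zero => simp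
  | add x₁ x₂ h₁ h₂ => rw [map_add, inner_add_left, inner_add_left, h₁, h₂]
  | tmul a b =>
    induction y using TensorProduct.induction_on with
    | zero => simp
    | add y₁ y₂ h₁ h₂ => rw [map_add, inner_add_right, inner_add_right, h₁, h₂]
    | tmul c d =>
      rw [ContinuousLinearMap.rTensor_tmul, ContinuousLinearMap.rTensor_tmul,
        TensorProduct.inner_tmul, TensorProduct.inner_tmul, hT]

theorem lTensor_symm {T : F →L[ℂ] F} (hT : ∀ x y, inner ℂ (T x) y = inner ℂ x (T y))
    (x y : E ⊗[ℂ] F) : inner ℂ (T.lTensor E x) y = inner ℂ x (T.lTensor E y) := by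
  induction x using TensorProduct.induction_on with
  | zero => simp
  | add x₁ x₂ h₁ h₂ => rw [map_add, inner_add_left, inner_add_left, h₁, h₂]
  | tmul a b =>
    induction y using TensorProduct.induction_on with
    | zero => simp
    | add y₁ y₂ h₁ h₂ => rw [map_add, inner_add_right, inner_add_right, h₁, h₂]
    | tmul c d =>
      rw [ContinuousLinearMap.lTensor_tmul, ContinuousLinearMap.lTensor_tmul,
        TensorProduct.inner_tmul, TensorProduct.inner_tmul, hT]

theorem commute_rTensor_lTensor (S : E →L[ℂ] E) (T : F →L[ℂ] F) :
    Commute (S.rTensor F) (T.lTensor E) := by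
  refine ContinuousLinearMap.ext fun x => ?_
  simp only [mul_apply_eq_comp]
  induction x using TensorProduct.induction_on with
  | zero => simp
  | add x y hx hy => simp only [map_add, hx, hy]
  | tmul a b =>
    rw [ContinuousLinearMap.lTensor_tmul, ContinuousLinearMap.rTensor_tmul,
      ContinuousLinearMap.rTensor_tmul, ContinuousLinearMap.lTensor_tmul]

theorem commute_completion {S T : E →L[ℂ] E} (h : Commute S T) :
    Commute S.completion T.completion := by
  rw [Commute, SemiconjBy, ← completion_mul, h.eq, completion_mul]

end Completion

section Joint

variable {HA : Type u} {HB : Type v}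
  [NormedAddCommGroup HA] [InnerProductSpace ℂ HA] [CompleteSpace HA]
  [NormedAddCommGroup HB] [InnerProductSpace ℂ HB] [CompleteSpace HB] {m : ℕ}
  (A : Question m → ProjMeas HA (Answer m)) (B : Question m → ProjMeas HB (Answer m))

theorem jointObs_comm_of_ne (q r : Question m) (k l : Site m) (h : k.isLeft ≠ l.isLeft) :
    Commute (jointObs A B q k) (jointObs A B r l) := by
  rcases k with k | k <;> rcases l with l | l
  · simp at h
  · exact commute_completion (commute_rTensor_lTensor _ _)
  · exact (commute_completion (commute_rTensor_lTensor _ _)).symm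
  · simp at h

theorem isReflectionFamily_jointObs (q : Question m) : IsReflectionFamily (jointObs A B q) where
  symm k := by
    rcases k with k | k
    · exact completion_symm (rTensor_symm ((A q).obs_symm k))
    · exact completion_symm (lTensor_symm ((B q).obs_symm k))
  mul_self k := by
    rcases k with k | k
    · change ContinuousLinearMap.completion _ * ContinuousLinearMap.completion _ = _
      rw [← completion_mul, ← ContinuousLinearMap.rTensor_mul, (A q).obs_mul_self,
        ContinuousLinearMap.rTensor_one, completion_one]
    · change ContinuousLinearMap.completion _ * ContinuousLinearMap.completion _ = _
      rw [← completion_mul, ← ContinuousLinearMap.lTensor_mul, (B q).obs_mul_self,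
        ContinuousLinearMap.lTensor_one, completion_one]
  comm k l := by
    by_cases h : k.isLeft = l.isLeft
    · rcases k with k | k <;> rcases l with l | l
      · refine commute_completion ?_
        rw [Commute, SemiconjBy, ← ContinuousLinearMap.rTensor_mul,
          ((A q).obs_comm k l).eq, ContinuousLinearMap.rTensor_mul]
      · simp at h
      · simp at h
      · refine commute_completion ?_
        rw [Commute, SemiconjBy, ← ContinuousLinearMap.lTensor_mul,
          ((B q).obs_comm k l).eq, ContinuousLinearMap.lTensor_mul]
    · exact jointObs_comm_of_ne A B q q k l h

end Joint

/-! ### Approximate Pauli relations from the correlations -/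

section Relations

variable {V : Type*} [NormedAddCommGroup V] [InnerProductSpace ℂ V]

theorem norm_sub_le_of_inner {a b : V} {ε : ℝ} (ha : ‖a‖ = 1) (hb : ‖b‖ = 1)
    (h : ‖inner ℂ a b - 1‖ ≤ ε) : ‖a - b‖ ≤ Real.sqrt (2 * ε) := by
  refine Real.le_sqrt_of_sq_le ?_
  rw [norm_sub_sq (𝕜 := ℂ), ha, hb]
  have h1 := (abs_le.1 ((Complex.abs_re_le_norm (inner ℂ a b - 1)).trans h)).1
  rw [Complex.sub_re, Complex.one_re] at h1
  rw [RCLike.re_to_complex]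
  linarith

/-- If `D` is correlated with `T` and with `U` as `(T + U) / √2` would be, and the correlation of
`T` and `U` is small, then `D ψ ≈ (T + U) ψ / √2`; since `D ^ 2 = 1` and `D` commutes with `T`
and `U`, this makes `T` and `U` anticommute approximately. -/
theorem norm_anticomm_le {T U D : V →L[ℂ] V} {ψ : V} {ε c : ℝ}
    (hψ : ‖ψ‖ = 1) (hT2 : T * T = 1) (hU2 : U * U = 1) (hD2 : D * D = 1)
    (hTn : ∀ v, ‖T v‖ = ‖v‖) (hUn : ∀ v, ‖U v‖ = ‖v‖) (hDn : ∀ v, ‖D v‖ = ‖v‖)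
    (hTD : Commute T D) (hUD : Commute U D)
    (h1 : ‖inner ℂ (T ψ) (D ψ) - ((1 / Real.sqrt 2 : ℝ) : ℂ)‖ ≤ ε)
    (h2 : ‖inner ℂ (U ψ) (D ψ) - ((1 / Real.sqrt 2 : ℝ) : ℂ)‖ ≤ ε)
    (h3 : (inner ℂ (T ψ) (U ψ)).re ≤ c) :
    ‖T (U ψ) + U (T ψ)‖ ≤ 2 * (1 + Real.sqrt 2) * Real.sqrt (c + 2 * Real.sqrt 2 * ε) := by
  set r := Real.sqrt 2 with hr
  have hr2 : r * r = 2 := Real.mul_self_sqrt (by norm_num)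
  have hr0 : 0 < r := Real.sqrt_pos.2 (by norm_num)
  have hinv : 1 / r = r / 2 := by
    rw [div_eq_div_iff hr0.ne' two_ne_zero, hr2, one_mul]
  rw [hinv] at h1 h2
  set R : V := D ψ - ((r / 2 : ℝ) : ℂ) • (T ψ + U ψ) with hR
  have hRle : ‖R‖ ≤ Real.sqrt (c + 2 * r * ε) := by
    refine Real.le_sqrt_of_sq_le ?_
    have g1 := (abs_le.1 ((Complex.abs_re_le_norm _).trans h1)).1
    have g2 := (abs_le.1 ((Complex.abs_re_le_norm _).trans h2)).1
    rw [Complex.sub_re, Complex.ofReal_re] at g1 g2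
    have e1 : (inner ℂ (D ψ) (((r / 2 : ℝ) : ℂ) • (T ψ + U ψ))).re
        = r / 2 * ((inner ℂ (T ψ) (D ψ)).re + (inner ℂ (U ψ) (D ψ)).re) := by
      rw [inner_smul_right, Complex.re_ofReal_mul, inner_add_right, Complex.add_re,
        ← inner_conj_symm (D ψ) (T ψ), ← inner_conj_symm (D ψ) (U ψ), Complex.conj_re,
        Complex.conj_re]
    have e2 : ‖T ψ + U ψ‖ ^ 2 = 2 + 2 * (inner ℂ (T ψ) (U ψ)).re := by
      rw [norm_add_sq (𝕜 := ℂ), hTn, hUn, hψ, RCLike.re_to_complex]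
      ring
    rw [hR, norm_sub_sq (𝕜 := ℂ), RCLike.re_to_complex, e1, norm_smul, mul_pow, e2, hDn, hψ,
      Complex.norm_real, Real.norm_eq_abs, sq_abs]
    nlinarith
  have hTT : ∀ v, T (T v) = v := fun v => DFunLike.congr_fun hT2 v
  have hUU : ∀ v, U (U v) = v := fun v => DFunLike.congr_fun hU2 v
  have hDD : ∀ v, D (D v) = v := fun v => DFunLike.congr_fun hD2 v
  have key : T (U ψ) + U (T ψ) = -((2 : ℂ) • D R + (r : ℂ) • (T R + U R)) := by
    have hrc : (r : ℂ) * ((r / 2 : ℝ) : ℂ) = 1 := by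
      rw [← Complex.ofReal_mul, ← mul_div_assoc, hr2]
      norm_num
    have h2c : (2 : ℂ) * ((r / 2 : ℝ) : ℂ) = r := by
      push_cast
      ring
    rw [hR]
    simp only [map_sub, map_smul, map_add, hTT, hUU, hDD, smul_sub, smul_add, smul_smul, hrc, h2c,
      one_smul, commute_apply hTD, commute_apply hUD, two_smul]
    abel
  rw [key, norm_neg]
  calc ‖(2 : ℂ) • D R + (r : ℂ) • (T R + U R)‖
      ≤ ‖(2 : ℂ) • D R‖ + ‖(r : ℂ) • (T R + U R)‖ := norm_add_le _ _
    _ ≤ 2 * ‖R‖ + r * (‖R‖ + ‖R‖) := by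
        rw [norm_smul, norm_smul, hDn, Complex.norm_real, Real.norm_eq_abs, abs_of_pos hr0]
        have := norm_add_le (T R) (U R)
        rw [hTn, hUn] at this
        norm_num
        exact mul_le_mul_of_nonneg_left this hr0.le
    _ = 2 * (1 + r) * ‖R‖ := by ring
    _ ≤ _ := mul_le_mul_of_nonneg_left hRle (by positivity)

/-- The error of the anticommutation relation, in terms of `g = (2 * ε) ^ (1 / 4)`. -/
def antiErr (g : ℝ) : ℝ :=
  2 * (1 + Real.sqrt 2) * g + (5 + 3 * Real.sqrt 2) / 2 * g ^ 3

theorem sqrt_le_antiErr {g : ℝ} (hg : 0 ≤ g) :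
    2 * (1 + Real.sqrt 2) * Real.sqrt ((g ^ 4 / 2 + g ^ 2) + 2 * Real.sqrt 2 * (g ^ 4 / 2))
      ≤ antiErr g := by
  set r := Real.sqrt 2 with hr
  have hr2 : r * r = 2 := Real.mul_self_sqrt (by norm_num)
  have hr0 : 0 < r := Real.sqrt_pos.2 (by norm_num)
  have h1 : Real.sqrt ((g ^ 4 / 2 + g ^ 2) + 2 * r * (g ^ 4 / 2))
      ≤ g * (1 + (1 + 2 * r) / 4 * g ^ 2) := by
    refine Real.sqrt_le_iff.2 ⟨by positivity, ?_⟩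
    have : 0 ≤ (g * ((1 + 2 * r) / 4 * g ^ 2)) ^ 2 := sq_nonneg _
    nlinarith
  calc _ ≤ 2 * (1 + r) * (g * (1 + (1 + 2 * r) / 4 * g ^ 2)) :=
        mul_le_mul_of_nonneg_left h1 (by positivity)
    _ = 2 * (1 + r) * g + (1 + 3 * r + 2 * (r * r)) / 2 * g ^ 3 := by ring
    _ = antiErr g := by rw [hr2, antiErr, ← hr]; ring

end Relations

section Correlations

variable {HA : Type u} {HB : Type v}
  [NormedAddCommGroup HA] [InnerProductSpace ℂ HA] [CompleteSpace HA]
  [NormedAddCommGroup HB] [InnerProductSpace ℂ HB] [CompleteSpace HB] {m : ℕ}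
  {A : Question m → ProjMeas HA (Answer m)} {B : Question m → ProjMeas HB (Answer m)}
  {ψ : Joint HA HB} {ε : ℝ}

/-- Two different e-bits are measured in different bases on some question, with a prescribed
choice of the basis for either. -/
theorem exists_question_X_Z {k l : Fin m} (hkl : k ≠ l) :
    ∃ q : Question m, honestMatrix q k = pauliX ∧ honestMatrix q l = pauliZ := by
  have hne : k.val + 1 ≠ l.val + 1 := fun h => hkl (Fin.ext (by omega))
  obtain ⟨j, hj⟩ := Nat.exists_testBit_ne_of_ne hne
  have hjm : j < Nat.size m := by
    by_contra hc
    have hsz : m < 2 ^ j := Nat.size_le.1 (not_lt.1 hc)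
    apply hj
    rw [Nat.testBit_lt_two_pow (by omega), Nat.testBit_lt_two_pow (by omega)]
  cases h1 : (k.val + 1).testBit j
  · have h2 : (l.val + 1).testBit j = true := by simpa [h1] using hj
    exact ⟨Question.Zbit ⟨j, hjm⟩, by simp [honestMatrix, h1], by simp [honestMatrix, h2]⟩
  · have h2 : (l.val + 1).testBit j = false := by simpa [h1] using hj
    exact ⟨Question.Xbit ⟨j, hjm⟩, by simp [honestMatrix, h1], by simp [honestMatrix, h2]⟩

/-- The correlations of the two sites of an e-bit are those of the ideal state, up to `ε`. -/
def CorrClose (A : Question m → ProjMeas HA (Answer m)) (B : Question m → ProjMeas HB (Answer m))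
    (ψ : Joint HA HB) (ε : ℝ) : Prop :=
  ∀ q r : Question m, (q.IsXZ ∨ r.IsXZ) → ∀ k : Site m,
    ‖inner ℂ (jointObs A B q k ψ) (jointObs A B r k.swap ψ)
      - inner ℂ (onSite (honestMatrix q (k.elim id id)) k (idealState m))
          (onSite (honestMatrix r (k.elim id id)) k.swap (idealState m))‖ ≤ ε

theorem corrClose_of_forall
    (hcorr : ∀ q r : Question m, (q.IsXZ ∨ r.IsXZ) → ∀ k : Fin m,
      ‖inner ℂ ψ (jointObs A B q (Sum.inl k) (jointObs A B r (Sum.inr k) ψ))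
        - inner ℂ (idealState m)
            (idealObs q (Sum.inl k) (idealObs r (Sum.inr k) (idealState m)))‖ ≤ ε) :
    CorrClose A B ψ ε := by
  have hsymm : ∀ (q : Question m) (k : Site m) (x y : Qubits m),
      inner ℂ (idealObs q k x) y = inner ℂ x (idealObs q k y) := fun q k => by
    rw [idealObs_eq]
    exact onSite_symm (isHermitian_honestMatrix q _) k
  intro q r hqr k
  rcases k with k | k
  · have h := hcorr q r hqr k
    rwa [← (isReflectionFamily_jointObs A B q).symm, ← hsymm] at h
  · have h := hcorr r q hqr.symm k
    rw [← (isReflectionFamily_jointObs A B r).symm, ← hsymm,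
      ← inner_conj_symm, ← inner_conj_symm (idealObs _ _ _), ← map_sub, RCLike.norm_conj] at h
    exact h

theorem norm_jointObs_apply (q : Question m) (k : Site m) (v : Joint HA HB) :
    ‖jointObs A B q k v‖ = ‖v‖ :=
  (isReflectionFamily_jointObs A B q).norm_apply k v

/-- A stabilizer relation: the observables that stand for `X` at a site and for `Z` at the partner
site agree on `ψ`. -/
theorem CorrClose.norm_sub_le (h : CorrClose A B ψ ε) (hψ : ‖ψ‖ = 1) {q r : Question m}
    (hqr : q.IsXZ ∨ r.IsXZ) {k : Site m} (hq : honestMatrix q (k.elim id id) = pauliX)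
    (hr : honestMatrix r (k.elim id id) = pauliZ) :
    ‖jointObs A B q k ψ - jointObs A B r k.swap ψ‖ ≤ Real.sqrt (2 * ε) := by
  refine norm_sub_le_of_inner (by rw [norm_jointObs_apply, hψ])
    (by rw [norm_jointObs_apply, hψ]) ?_
  have := h q r hqr k
  rwa [hq, hr, inner_pauliX_pauliZ] at this

theorem elim_swap (k : Site m) : k.swap.elim id id = k.elim id id := by
  rcases k with k | k <;> rfl

/-- The observables for `X` and `Z` at different sites commute approximately: on a suitable
question of the other player, the two partner observables are measured jointly. -/
theorem CorrClose.norm_comm_le (h : CorrClose A B ψ ε) (hψ : ‖ψ‖ = 1) {k l : Site m}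
    (hkl : k ≠ l) :
    ‖jointObs A B Question.X k (jointObs A B Question.Z l ψ)
        - jointObs A B Question.Z l (jointObs A B Question.X k ψ)‖
      ≤ 4 * Real.sqrt (2 * ε) := by
  by_cases hside : k.isLeft = l.isLeft
  · have hidx : l.elim id id ≠ k.elim id id := by
      rcases k with k | k <;> rcases l with l | l
      · exact fun e => hkl (congrArg Sum.inl e.symm)
      · simp at hside
      · simp at hside
      · exact fun e => hkl (congrArg Sum.inr e.symm)
    obtain ⟨r, hrl, hrk⟩ := exists_question_X_Z hidx
    have hk := h.norm_sub_le hψ (q := Question.X) (r := r) (Or.inl (Or.inl rfl)) (k := k) rfl hrk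
    have hl := h.norm_sub_le hψ (q := r) (r := Question.Z) (Or.inr (Or.inr rfl)) (k := l.swap)
      (by rw [elim_swap, hrl]) rfl
    rw [Sum.swap_swap] at hl
    have hRX : Commute (jointObs A B Question.X k) (jointObs A B r l.swap) :=
      jointObs_comm_of_ne A B _ _ _ _ (by rw [hside]; exact (isLeft_swap_ne l).symm)
    have hTZ : Commute (jointObs A B Question.Z l) (jointObs A B r k.swap) :=
      jointObs_comm_of_ne A B _ _ _ _ (by rw [← hside]; exact (isLeft_swap_ne k).symm)
    have hRT := (isReflectionFamily_jointObs A B r).comm l.swap k.swap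
    have nX := norm_jointObs_apply (A := A) (B := B) Question.X k
    have nZ := norm_jointObs_apply (A := A) (B := B) Question.Z l
    have nR := norm_jointObs_apply (A := A) (B := B) r l.swap
    have nT := norm_jointObs_apply (A := A) (B := B) r k.swap
    generalize jointObs A B Question.X k = X at *
    generalize jointObs A B Question.Z l = Z at *
    generalize jointObs A B r l.swap = R at *
    generalize jointObs A B r k.swap = T at *
    have e : X (Z ψ) - Z (X ψ)
        = X (Z ψ - R ψ) + R (X ψ - T ψ) + T (R ψ - Z ψ) + Z (T ψ - X ψ) := by
      simp only [map_sub, commute_apply hRX, commute_apply hTZ, commute_apply hRT]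
      abel
    rw [e]
    refine (norm_add_le _ _).trans ?_
    refine (add_le_add (norm_add_le _ _) le_rfl).trans ?_
    refine (add_le_add (add_le_add (norm_add_le _ _) le_rfl) le_rfl).trans ?_
    rw [nX, nR, nT, nZ, norm_sub_rev (Z ψ), norm_sub_rev (T ψ)]
    linarith
  · rw [commute_apply (jointObs_comm_of_ne A B _ _ _ _ hside), sub_self, norm_zero]
    positivity

theorem CorrClose.norm_anticomm_le (h : CorrClose A B ψ ε) (hψ : ‖ψ‖ = 1) (k : Site m) :
    ‖jointObs A B Question.X k (jointObs A B Question.Z k ψ)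
        + jointObs A B Question.Z k (jointObs A B Question.X k ψ)‖
      ≤ 2 * (1 + Real.sqrt 2)
        * Real.sqrt ((ε + Real.sqrt (2 * ε)) + 2 * Real.sqrt 2 * ε) := by
  have rX := isReflectionFamily_jointObs A B (Question.X : Question m)
  have rZ := isReflectionFamily_jointObs A B (Question.Z : Question m)
  have rD := isReflectionFamily_jointObs A B (Question.D : Question m)
  have hXD := h Question.X Question.D (Or.inl (Or.inl rfl)) k
  have hZD := h Question.Z Question.D (Or.inl (Or.inr rfl)) k
  have hXX := h Question.X Question.X (Or.inl (Or.inl rfl)) k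
  simp only [honestMatrix] at hXD hZD hXX
  rw [inner_pauliX_pauliD] at hXD
  rw [inner_pauliZ_pauliD] at hZD
  rw [inner_pauliX_pauliX, sub_zero] at hXX
  refine ParallelMayersYao.norm_anticomm_le hψ (rX.mul_self k) (rZ.mul_self k)
    (rD.mul_self k.swap) (rX.norm_apply k) (rZ.norm_apply k) (rD.norm_apply k.swap)
    (jointObs_comm_of_ne A B _ _ _ _ (isLeft_swap_ne k).symm)
    (jointObs_comm_of_ne A B _ _ _ _ (isLeft_swap_ne k).symm) hXD hZD ?_
  have hst := h.norm_sub_le hψ (q := Question.X) (r := Question.Z) (Or.inl (Or.inl rfl))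
    (k := k.swap) rfl rfl
  rw [Sum.swap_swap, norm_sub_rev] at hst
  have e : inner ℂ (jointObs A B Question.X k ψ) (jointObs A B Question.Z k ψ)
      = inner ℂ (jointObs A B Question.X k ψ) (jointObs A B Question.X k.swap ψ)
        + inner ℂ (jointObs A B Question.X k ψ)
          (jointObs A B Question.Z k ψ - jointObs A B Question.X k.swap ψ) := by
    rw [inner_sub_right]
    ring
  rw [e]
  refine (Complex.re_le_norm _).trans ((norm_add_le _ _).trans (add_le_add hXX ?_))
  refine (norm_inner_le_norm _ _).trans ?_
  rwa [rX.norm_apply, hψ, one_mul]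

/-- Correlations close to the ideal ones force approximate Pauli relations. -/
theorem CorrClose.approxPauli (h : CorrClose A B ψ ε) (hψ : ‖ψ‖ = 1) {g : ℝ} (hg : 0 ≤ g)
    (hε : 2 * ε = g ^ 4) :
    ApproxPauli (jointObs A B Question.X) (jointObs A B Question.Z) ψ (g ^ 2) (antiErr g) where
  reflX := isReflectionFamily_jointObs A B _
  reflZ := isReflectionFamily_jointObs A B _
  comm_of_ne k l hkl := jointObs_comm_of_ne A B _ _ _ _ hkl
  delta_nonneg := sq_nonneg g
  eta_nonneg := by unfold antiErr; positivity
  stab k := by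
    have := h.norm_sub_le hψ (q := Question.X) (r := Question.Z) (Or.inl (Or.inl rfl))
      (k := k) rfl rfl
    rwa [hε, show g ^ 4 = (g ^ 2) ^ 2 by ring, Real.sqrt_sq (sq_nonneg g)] at this
  anti k := by
    have := h.norm_anticomm_le hψ k
    rw [hε, show g ^ 4 = (g ^ 2) ^ 2 by ring, Real.sqrt_sq (sq_nonneg g),
      show ε = g ^ 4 / 2 by linarith] at this
    exact this.trans (sqrt_le_antiErr hg)
  almost_comm k l hkl := by
    have := h.norm_comm_le hψ hkl
    rwa [hε, show g ^ 4 = (g ^ 2) ^ 2 by ring, Real.sqrt_sq (sq_nonneg g)] at this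

/-- Without any e-bits all relations hold trivially, whatever the correlations. -/
theorem approxPauli_zero (A : Question 0 → ProjMeas HA (Answer 0))
    (B : Question 0 → ProjMeas HB (Answer 0)) (ψ : Joint HA HB) :
    ApproxPauli (jointObs A B Question.X) (jointObs A B Question.Z) ψ 0 0 where
  reflX := isReflectionFamily_jointObs A B _
  reflZ := isReflectionFamily_jointObs A B _
  comm_of_ne _ _ hkl := jointObs_comm_of_ne A B _ _ _ _ hkl
  delta_nonneg := le_rfl
  eta_nonneg := le_rfl
  stab k := isEmptyElim k
  anti k := isEmptyElim k
  almost_comm k := isEmptyElim k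

end Correlations

/-! ### Comparison with the stated bound -/

theorem eps4_eq {ε g : ℝ} (hg : 0 ≤ g) (hε : 2 * ε = g ^ 4) :
    eps4 ε = 2 * antiErr g + 8 * g ^ 2 := by
  have h1 : (g ^ 4) ^ (1 / 4 : ℝ) = g := by
    rw [← Real.rpow_natCast, ← Real.rpow_mul hg]; norm_num
  have h3 : (g ^ 4) ^ (3 / 4 : ℝ) = g ^ 3 := by
    rw [← Real.rpow_natCast, ← Real.rpow_natCast, ← Real.rpow_mul hg]; norm_num
  have h2 : Real.sqrt (g ^ 4) = g ^ 2 := by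
    rw [show g ^ 4 = (g ^ 2) ^ 2 by ring, Real.sqrt_sq (sq_nonneg g)]
  unfold eps4 antiErr
  rw [hε, h1, h2, h3]
  ring

theorem robustnessBound_nonneg (n w ε : ℝ) : 0 ≤ robustnessBound n w ε :=
  add_nonneg (Real.sqrt_nonneg _) (Real.sqrt_nonneg _)

/-- The linear error of the swap isometry is at most the stated bound, unless the latter
exceeds the trivial bound `2`. -/
theorem min_le_robustnessBound {ε g n w : ℝ} (hg : 0 ≤ g) (hε : 2 * ε = g ^ 4) (hn : 2 ≤ n)
    (hw : 0 ≤ w) (hwn : w ≤ n) :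
    min 2 ((antiErr g + 4 * g ^ 2 + 6 * g ^ 2 * (n / 2 - 1)) * (w + 0.71 * n)
        + n / 2 * (antiErr g + 5 * g ^ 2 + 6 * g ^ 2 * (n / 2 - 1)))
      ≤ robustnessBound n w ε := by
  have hsq : Real.sqrt (2 * ε) = g ^ 2 := by
    rw [hε, show g ^ 4 = (g ^ 2) ^ 2 by ring, Real.sqrt_sq (sq_nonneg g)]
  have he4 := eps4_eq hg hε
  have ha : antiErr g = eps4 ε / 2 - 4 * g ^ 2 := by linarith
  -- `ε₄` dominates `(2 * ε) ^ (1 / 4)`, so that `√(2 * ε)` is quadratically small in `ε₄`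
  have heg : 9.6 * g ≤ eps4 ε := by
    have hr : 1.4 ≤ Real.sqrt 2 := Real.le_sqrt_of_sq_le (by norm_num)
    have h1 : 0 ≤ (5 + 3 * Real.sqrt 2) * g ^ 3 := by positivity
    have h2 : 1.4 * g ≤ Real.sqrt 2 * g := mul_le_mul_of_nonneg_right hr hg
    rw [he4, antiErr]
    nlinarith [sq_nonneg g]
  unfold robustnessBound
  rw [hsq, ha]
  set d := g ^ 2 with hd
  set e := eps4 ε
  have hd0 : 0 ≤ d := sq_nonneg g
  have he0 : 0 ≤ e := le_trans (by positivity) heg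
  have hde : 92 * d ≤ e ^ 2 := by
    have := pow_le_pow_left₀ (by positivity) heg 2
    rw [mul_pow, ← hd] at this
    linarith
  clear_value d e
  set B1 := d * (9 * n ^ 2 / 4 + 3 * n / 2) + n * e / 2 with hB1
  set B2 := d * (9 * n ^ 2 / 8 + n * (5 * w / 2 - 1 / 4) - w / 2) + e * (n / 4 + w / 2) with hB2
  have hn0 : 0 ≤ n := by linarith
  have hb1 : n * e / 2 ≤ B1 := by
    have : 0 ≤ d * (9 * n ^ 2 / 4 + 3 * n / 2) := by positivity
    linarith
  have hb2 : e * (n / 4 + w / 2) ≤ B2 := by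
    have : 0 ≤ d * (9 * n ^ 2 / 8 + n * (5 * w / 2 - 1 / 4) - w / 2) := by
      refine mul_nonneg hd0 ?_
      nlinarith [mul_nonneg hw (sub_nonneg.2 hn)]
    linarith
  have hb10 : 0 ≤ n * e / 2 := by positivity
  have hb20 : 0 ≤ e * (n / 4 + w / 2) := by positivity
  have hcross : e * (0.35 * n + 0.25 * w) ≤ Real.sqrt B1 * Real.sqrt B2 := by
    rw [← Real.sqrt_mul (hb10.trans hb1)]
    refine Real.le_sqrt_of_sq_le ((?_ : _ ≤ n * e / 2 * (e * (n / 4 + w / 2))).trans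
      (mul_le_mul hb1 hb2 hb20 (hb10.trans hb1)))
    have : (0.35 * n + 0.25 * w) ^ 2 ≤ n / 2 * (n / 4 + w / 2) := by nlinarith
    calc (e * (0.35 * n + 0.25 * w)) ^ 2 = e ^ 2 * (0.35 * n + 0.25 * w) ^ 2 := by ring
      _ ≤ e ^ 2 * (n / 2 * (n / 4 + w / 2)) := mul_le_mul_of_nonneg_left this (sq_nonneg e)
      _ = _ := by ring
  set S := Real.sqrt B1 + Real.sqrt B2 with hS
  have hS0 : 0 ≤ S := add_nonneg (Real.sqrt_nonneg _) (Real.sqrt_nonneg _)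
  have hSsq : B1 + B2 + 2 * (e * (0.35 * n + 0.25 * w)) ≤ S ^ 2 := by
    have h1 := Real.sq_sqrt (hb10.trans hb1)
    have h2 := Real.sq_sqrt (hb20.trans hb2)
    rw [hS, add_sq, h1, h2]
    linarith
  by_cases hS2 : 2 ≤ S
  · exact (min_le_left _ _).trans hS2
  refine (min_le_right _ _).trans ?_
  rw [not_le] at hS2
  have hS4 : S ^ 2 ≤ 2 * S := by nlinarith
  have h4 : 1.45 * (n * e) + w * e ≤ 4 := by nlinarith
  have hsmall : d * (3.885 * n ^ 2 + 3.5 * (n * w)) ≤ 0.24 * (n * e) := by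
    have h1 : 92 * d * (3.885 * n ^ 2 + 3.5 * (n * w))
        ≤ e ^ 2 * (3.885 * n ^ 2 + 3.5 * (n * w)) :=
      mul_le_mul_of_nonneg_right hde (by positivity)
    have h2 : e ^ 2 * (3.885 * n ^ 2 + 3.5 * (n * w))
        = n * e * (3.885 * (n * e) + 3.5 * (w * e)) := by ring
    have h3 : n * e * (3.885 * (n * e) + 3.5 * (w * e)) ≤ n * e * 14 := by
      have h0 : 0 ≤ n * e := by positivity
      refine mul_le_mul_of_nonneg_left ?_ h0
      linarith
    linarith [mul_nonneg hn0 he0]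
  have hdn : 0 ≤ d * n := by positivity
  have hdw : 0 ≤ d * w := by positivity
  suffices h : 2 * ((e / 2 - 4 * d + 4 * d + 6 * d * (n / 2 - 1)) * (w + 0.71 * n)
      + n / 2 * (e / 2 - 4 * d + 5 * d + 6 * d * (n / 2 - 1))) ≤ S ^ 2 by linarith
  refine le_trans ?_ hSsq
  rw [hB1, hB2]
  ring_nf at hsmall hdn hdw ⊢
  linarith

theorem card_question (m : ℕ) : Nat.card (Question m) = 2 * Nat.log 2 (2 * m) + 3 := by
  let f : Question m ≃ Fin 3 ⊕ (Fin (Nat.size m) ⊕ Fin (Nat.size m)) :=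
    { toFun := fun q => match q with
        | .X => Sum.inl 0
        | .Z => Sum.inl 1
        | .D => Sum.inl 2
        | .Xbit j => Sum.inr (Sum.inl j)
        | .Zbit j => Sum.inr (Sum.inr j)
      invFun := fun s => match s with
        | Sum.inl i => ![Question.X, Question.Z, Question.D] i
        | Sum.inr (Sum.inl j) => .Xbit j
        | Sum.inr (Sum.inr j) => .Zbit j
      left_inv := fun q => by cases q <;> rfl
      right_inv := fun s => by
        rcases s with i | j | j
        · fin_cases i <;> rfl
        · rfl
        · rfl }
  have hsize : Nat.size m = Nat.log 2 (2 * m) := by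
    rcases Nat.eq_zero_or_pos m with rfl | hm
    · simp
    · refine (Nat.log_eq_of_pow_le_of_lt_pow ?_ ?_).symm
      · have hs : 0 < Nat.size m := Nat.size_pos.2 hm
        have : 2 ^ (Nat.size m - 1) ≤ m := Nat.lt_size.1 (by omega)
        calc 2 ^ Nat.size m = 2 * 2 ^ (Nat.size m - 1) := by
              rw [← pow_succ', Nat.sub_add_cancel hs]
          _ ≤ 2 * m := Nat.mul_le_mul_left 2 this
      · rw [pow_succ']
        exact Nat.mul_lt_mul_of_pos_left (Nat.lt_size_self m) two_pos
  rw [Nat.card_congr f, Nat.card_eq_fintype_card]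
  simp only [Fintype.card_sum, Fintype.card_fin]
  omega

end ParallelMayersYao

end

theorem theorem1 {HA : Type u} {HB : Type v}
    [NormedAddCommGroup HA] [InnerProductSpace ℂ HA] [CompleteSpace HA]
    [NormedAddCommGroup HB] [InnerProductSpace ℂ HB] [CompleteSpace HB]
    (m : ℕ)
    (A : Question m → ProjMeas HA (Answer m)) (B : Question m → ProjMeas HB (Answer m))
    (ψ' : Joint HA HB) (hψ' : ‖ψ'‖ = 1) (ε : ℝ)
    (hcorr : ∀ q r : Question m, (q.IsXZ ∨ r.IsXZ) → ∀ k : Fin m,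
      ‖inner ℂ ψ' (jointObs A B q (Sum.inl k) (jointObs A B r (Sum.inr k) ψ'))
        - inner ℂ (idealState m)
            (idealObs q (Sum.inl k) (idealObs r (Sum.inr k) (idealState m)))‖ ≤ ε) :
    Nat.card (Question m) = 2 * Nat.log 2 (2 * m) + 3 ∧
    ∃ (K : Type (max u v)) (_ : NormedAddCommGroup K) (_ : InnerProductSpace ℂ K)
      (_ : CompleteSpace K) (Φ : Joint HA HB →ₗᵢ[ℂ] K ⊗[ℂ] Qubits m) (junk : K),
      ‖junk‖ = 1 ∧
      ∀ p q : BitString m,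
        ‖Φ (bitPow (jointObs A B Question.X) q (bitPow (jointObs A B Question.Z) p ψ'))
          - junk ⊗ₜ[ℂ] (bitPow (idealObs Question.X) q
              (bitPow (idealObs Question.Z) p (idealState m)))‖
        ≤ robustnessBound (2 * m) (hammingNorm p) ε := by
  refine ⟨card_question m, Joint HA HB, inferInstance, inferInstance, inferInstance, ?_⟩
  rcases Nat.eq_zero_or_pos m with rfl | hm
  · obtain ⟨Φ, junk, hj, hΦ⟩ := (approxPauli_zero A B ψ').exists_isometry hψ'
    refine ⟨Φ, junk, hj, fun p q => (hΦ p q).trans ?_⟩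
    simpa using robustnessBound_nonneg _ _ ε
  · have hε0 : 0 ≤ ε :=
      (norm_nonneg _).trans (hcorr Question.X Question.X (Or.inl (Or.inl rfl)) ⟨0, hm⟩)
    obtain ⟨g, hg, hgε⟩ : ∃ g : ℝ, 0 ≤ g ∧ 2 * ε = g ^ 4 := by
      refine ⟨Real.sqrt (Real.sqrt (2 * ε)), Real.sqrt_nonneg _, ?_⟩
      rw [show ∀ x : ℝ, x ^ 4 = (x ^ 2) ^ 2 from fun x => by ring,
        Real.sq_sqrt (Real.sqrt_nonneg _), Real.sq_sqrt (by positivity)]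
    have hAP := (corrClose_of_forall hcorr).approxPauli hψ' hg hgε
    obtain ⟨Φ, junk, hj, hΦ⟩ := hAP.exists_isometry hψ'
    refine ⟨Φ, junk, hj, fun p q => ?_⟩
    have hw : (hammingNorm p : ℝ) ≤ 2 * m := by exact_mod_cast hammingNorm_le p
    have hm2 : (2 : ℝ) ≤ 2 * m := by
      have : (1 : ℝ) ≤ m := by exact_mod_cast hm
      linarith
    refine le_trans (le_min ?_ ?_)
      (min_le_robustnessBound hg hgε hm2 (Nat.cast_nonneg _) hw)
    · -- both vectors are unit vectors
      have hI : ‖bitPow (idealObs Question.X) q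
          (bitPow (idealObs Question.Z) p (idealState m))‖ = 1 := by
        have h1 : ‖bitPow (idealObs Question.X) q
            (bitPow (idealObs Question.Z) p (idealState m))‖ ^ 2 = ‖idealState m‖ ^ 2 := by
          rw [EuclideanSpace.norm_sq_eq, EuclideanSpace.norm_sq_eq]
          simp only [bitPow_idealObs_X_apply, bitPow_idealObs_Z_apply, norm_mul, norm_chi, one_mul]
          exact sum_add_right (fun s => ‖idealState m s‖ ^ 2) q
        rw [norm_idealState] at h1
        exact (pow_eq_one_iff_of_nonneg (norm_nonneg _) two_ne_zero).1 (by simpa using h1)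
      refine (norm_sub_le _ _).trans ?_
      rw [Φ.norm_map, hAP.reflX.norm_bitPow_apply, hAP.reflZ.norm_bitPow_apply, hψ',
        TensorProduct.norm_tmul, hj, hI]
      norm_num
    · refine (hΦ p q).trans_eq ?_
      ring
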